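/- Let $\{m(j)\}_{j\in\mathbb Z}$ be i.i.d. random variables with values almost surely in $[a_m,b_m]$, $0<a_m$, and let $\{1/k(j)\}_{j\in\mathbb Z}$ be i.i.d. random variables with values almost surely in $[a_k,b_k]$, $0<a_k$, all defined on one probability space. Put $\bar m=\mathbb E[m(0)]$, $1/\tilde k=\mathbb E[1/k(0)]$ and $c=\sqrt{\tilde k/\bar m}$. For $F:\mathbb R\to\mathbb R$ with weak derivatives $F^{(i)}$ let $$\|F\|_{H^3_{LIL}}=\sum_{i=0}^{3}\Big\|\big(1+|\cdot|\log\log(|\cdot|+e)\big)^{1/2}F^{(i)}\Big\|_{L^2(\mathbb R)},$$ and let $H^3_{LIL}$ be the space of functions, taken as their continuous representatives, for which this norm is finite. Fix $T_0>0$. For almost every realization of $\{k(j)\}$ and $\{m(j)\}$ the following holds. There is a finite positive number $C_\omega$, depending on $\Phi$ and $\Psi$ below only through $\|\Phi\|_{H^3_{LIL}}$ and $\|\Psi\|_{H^3_{LIL}}$, and not depending on $\epsilon$ (it may depend on the realization, on the laws of the coefficients and on $T_0$), such that for all $\Phi,\Psi\in H^3_{LIL}$ and all $\epsilon\in(0,1/2)$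 the lattice system $$\dot r(j,t)=p(j+1,t)-p(j,t),\qquad \dot p(j,t)=\frac1{m(j)}\big(k(j)r(j,t)-k(j-1)r(j-1,t)\big),\qquad j\in\mathbb Z,\ t\in\mathbb R,$$ with initial data $r(j,0)=\Phi(\epsilon j)/k(j)$ and $p(j,0)=\Psi(\epsilon j)$, has a unique solution that is differentiable in $t$ with values in $\ell^2(\mathbb Z)\times\ell^2(\mathbb Z)$, and this solution satisfies $$\sup_{|t|\le T_0/\epsilon}\Big\|r(\cdot,t)-\frac1{k(\cdot)}\big(A(\epsilon(\cdot-ct))+B(\epsilon(\cdot+ct))\big)\Big\|_{\ell^2}\le C_\omega\sqrt{\log\log(1/\epsilon+e)}$$ and $$\sup_{|t|\le T_0/\epsilon}\Big\|p(\cdot,t)-\frac1{\sqrt{\tilde k\bar m}}\big(-A(\epsilon(\cdot-ct))+B(\epsilon(\cdot+ct))\big)\Big\|_{\ell^2}\le C_\omega\sqrt{\log\log(1/\epsilon+e)},$$ where $$A(X)=\tfrac12\Phi(X)-\tfrac{\sqrt{\tilde k\bar m}}2\Psi(X),\qquad B(X)=\tfrac12\Phi(X)+\tfrac{\sqrt{\tilde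 k\bar m}}2\Psi(X).$$ (For $\epsilon\in(0,1/3]$ the quantity $\log\log(1/\epsilon+e)$ is bounded by a numerical constant times $\log\log(1/\epsilon)$, so there the bounds hold with $\sqrt{\log\log(1/\epsilon)}$ on the right, with another constant $C_\omega$.) -/

import Mathlib

open MeasureTheory ProbabilityTheory
open scoped ENNReal

noncomputable section

namespace RandomLattice

/-- The weight `(1 + |x| log log (|x| + e))^{1/2}`. -/
def lilWeight (x : ℝ) : ℝ :=
  Real.sqrt (1 + |x| * Real.log (Real.log (|x| + Real.exp 1)))

/-- `G` is a weak derivative of order `i` of `F` on the real line. -/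
structure IsWeakDeriv (i : ℕ) (F G : ℝ → ℝ) : Prop where
  locallyIntegrable_left : LocallyIntegrable F volume
  locallyIntegrable_right : LocallyIntegrable G volume
  integral_eq : ∀ φ : ℝ → ℝ, ContDiff ℝ (⊤ : ℕ∞) φ → HasCompactSupport φ →
    ∫ x, F x * iteratedDeriv i φ x = (-1 : ℝ) ^ i * ∫ x, G x * φ x

/-- The norm `∑_{i ≤ s} ‖(1 + |·| log log (|·| + e))^{1/2} F^{(i)}‖_{L²}`, with `F^{(i)}` the weak
derivative of order `i`. Weak derivatives are unique almost everywhere, so that the infimum is over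
a single value; it is `∞` if there is no weak derivative of that order. -/
def lilNorm (s : ℕ) (F : ℝ → ℝ) : ℝ≥0∞ :=
  ∑ i ∈ Finset.range (s + 1), ⨅ (G : ℝ → ℝ) (_ : IsWeakDeriv i F G),
    eLpNorm (fun x => lilWeight x * G x) 2 volume

/-- Membership of a function in the weighted Sobolev space, for `s ≥ 1`. Elements of that space are
identified with their continuous representatives, since they are sampled at points. -/
structure MemHLil (s : ℕ) (F : ℝ → ℝ) : Prop where
  continuous : Continuous F
  lilNorm_lt_top : lilNorm s F < ∞

/-- The Hilbert space of square summable real sequences indexed by the integers. -/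
abbrev EllTwo : Type := lp (fun _ : ℤ => ℝ) 2

/-- The `ℓ²` norm of an arbitrary sequence, `∞` if the sequence is not square summable. -/
def ellTwoNorm (x : ℤ → ℝ) : ℝ≥0∞ :=
  eLpNorm x 2 Measure.count

/-- `(r, p)` is a global `ℓ²`-valued solution of `r' = δ⁺ p`, `p' = (1 / m) δ⁻ (k r)`, where
`(δ⁺ f)(j) = f (j + 1) - f j` and `(δ⁻ f)(j) = f j - f (j - 1)`, with initial data `r₀`, `p₀`. -/
structure IsSolution (k m r₀ p₀ : ℤ → ℝ) (r p : ℝ → EllTwo) : Prop where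
  differentiable_r : Differentiable ℝ r
  differentiable_p : Differentiable ℝ p
  deriv_r : ∀ (t : ℝ) (j : ℤ), deriv r t j = p t (j + 1) - p t j
  deriv_p : ∀ (t : ℝ) (j : ℤ),
    deriv p t j = (1 / m j) * (k j * r t j - k (j - 1) * r t (j - 1))
  init_r : ∀ j : ℤ, r 0 j = r₀ j
  init_p : ∀ j : ℤ, p 0 j = p₀ j

/-- The right-moving profile `A = Φ / 2 - √(k̃ m̄) Ψ / 2`. -/
def profileA (kt mb : ℝ) (Φ Ψ : ℝ → ℝ) (X : ℝ) : ℝ :=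
  1 / 2 * Φ X - Real.sqrt (kt * mb) / 2 * Ψ X

/-- The left-moving profile `B = Φ / 2 + √(k̃ m̄) Ψ / 2`. -/
def profileB (kt mb : ℝ) (Φ Ψ : ℝ → ℝ) (X : ℝ) : ℝ :=
  1 / 2 * Φ X + Real.sqrt (kt * mb) / 2 * Ψ X

/-- The wave speed `c = √(k̃ / m̄)`. -/
def waveSpeed (kt mb : ℝ) : ℝ :=
  Real.sqrt (kt / mb)

/-- The profile `(1 / k(j)) (A(ε(j - ct)) + B(ε(j + ct)))`. -/
def approxR (kt mb : ℝ) (Φ Ψ : ℝ → ℝ) (ε : ℝ) (k : ℤ → ℝ) (t : ℝ) (j : ℤ) : ℝ :=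
  1 / k j * (profileA kt mb Φ Ψ (ε * (j - waveSpeed kt mb * t)) +
    profileB kt mb Φ Ψ (ε * (j + waveSpeed kt mb * t)))

/-- The profile `(1 / √(k̃ m̄)) (-A(ε(j - ct)) + B(ε(j + ct)))`. -/
def approxP (kt mb : ℝ) (Φ Ψ : ℝ → ℝ) (ε : ℝ) (t : ℝ) (j : ℤ) : ℝ :=
  1 / Real.sqrt (kt * mb) * (-profileA kt mb Φ Ψ (ε * (j - waveSpeed kt mb * t)) +
    profileB kt mb Φ Ψ (ε * (j + waveSpeed kt mb * t)))

end RandomLattice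

end

/-!
# Wave propagation in a harmonic lattice with random coefficients

On the macroscopic scale the lattice is a wave equation with the averaged coefficients `1 / k̃`
and `m̄`. Inserting its d'Alembert solution, with fields `Q = A + B` for the force `k r` and
`P = (B - A) / √(k̃ m̄)` for the velocity `p`, into the lattice leaves residuals of order `ε`,
proportional to the fluctuations `k̃ / k(j) - 1` and `m(j) / m̄ - 1`. These fluctuations are the
increments of two-sided random walks `a` and `b` (`intWalk`). Replacing `Q` by `Q + ε b Q'` and
`P` by `P + ε a P'` cancels the residuals of order `ε`; the new ones are of order `ε²` and carry
one factor `a` or `b` and one second derivative of the profiles. The energy `∑ (k r² + m p²)` of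
the lattice (`exists_norm_le_of_residual`) turns this into an error `O(ε ‖ρ D‖)` over times of
order `1 / ε` (`exists_norm_sub_wave_le`), where `ρ` dominates `a` and `b`, and `D` dominates the
lattice samples of the profiles and their first two derivatives. The correctors themselves have
the same size.

Two facts bound `‖ρ D‖`. Almost surely the walks grow at most like `√(|j| log log |j|)`
(`ae_exists_abs_intWalk_le`); this is the easy half of the law of the iterated logarithm, obtained
from Doob's maximal inequality for the exponential submartingale, Hoeffding's lemma and the
Borel–Cantelli lemma along dyadic times. And Sobolev's inequality on unit intervals compares sums
over the lattice with integrals (`exists_sample_majorant`): each sample of a derivative of order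
at most two is bounded by an `L²` norm over a window, where one more derivative is spent, and a
point belongs to `O(1 / ε)` windows. Since the squared weight at the lattice point `x / ε` is at
most a constant times `ε⁻¹ log log ε⁻¹` times the squared weight at the macroscopic point `x`,
this gives `‖ρ D‖ ≤ C ε⁻¹ √(log log ε⁻¹) (‖Φ‖ + ‖Ψ‖)`.
-/

namespace RandomLattice

/-! ### The iterated logarithm and the weight -/

/-- The iterated logarithm `log log (x + e)`, shifted to be nonnegative for `0 ≤ x`. -/
noncomputable def logLog (x : ℝ) : ℝ := Real.log (Real.log (x + Real.exp 1))

lemma one_le_log_add_exp {x : ℝ} (hx : 0 ≤ x) : 1 ≤ Real.log (x + Real.exp 1) := by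
  rw [Real.le_log_iff_exp_le (by positivity)]
  linarith

lemma logLog_nonneg {x : ℝ} (hx : 0 ≤ x) : 0 ≤ logLog x :=
  Real.log_nonneg (one_le_log_add_exp hx)

lemma logLog_pos {x : ℝ} (hx : 0 < x) : 0 < logLog x := by
  refine Real.log_pos ?_
  rw [Real.lt_log_iff_exp_lt (by positivity)]
  linarith

lemma logLog_mono {x y : ℝ} (hx : 0 ≤ x) (hxy : x ≤ y) : logLog x ≤ logLog y := by
  have h1 := one_le_log_add_exp hx
  exact Real.log_le_log (by linarith) (Real.log_le_log (by positivity) (by linarith))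

lemma logLog_mul_le {x y : ℝ} (hx : 0 ≤ x) (hy : 0 ≤ y) :
    logLog (x * y) ≤ Real.log 2 + logLog x + logLog y := by
  have h1 := one_le_log_add_exp hx
  have h2 := one_le_log_add_exp hy
  have h3 := one_le_log_add_exp (mul_nonneg hx hy)
  have he : 1 ≤ Real.exp 1 := Real.one_le_exp (by norm_num)
  have h4 : Real.log (x * y + Real.exp 1) ≤
      Real.log (x + Real.exp 1) + Real.log (y + Real.exp 1) := by
    rw [← Real.log_mul (by positivity) (by positivity)]
    refine Real.log_le_log (by positivity) ?_
    nlinarith [mul_nonneg hx (Real.exp_pos 1).le, mul_nonneg hy (Real.exp_pos 1).le]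
  unfold logLog
  rw [← Real.log_mul (by norm_num) (by linarith), ← Real.log_mul (by linarith) (by linarith)]
  refine Real.log_le_log (by linarith) (h4.trans ?_)
  nlinarith

lemma lilWeight_sq (x : ℝ) : lilWeight x ^ 2 = 1 + |x| * logLog |x| :=
  Real.sq_sqrt (add_nonneg zero_le_one
    (mul_nonneg (abs_nonneg x) (logLog_nonneg (abs_nonneg x))))

lemma one_le_lilWeight (x : ℝ) : 1 ≤ lilWeight x := by
  refine Real.one_le_sqrt.mpr ?_
  have := mul_nonneg (abs_nonneg x) (logLog_nonneg (abs_nonneg x))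
  simp only [logLog] at this
  linarith

lemma lilWeight_pos (x : ℝ) : 0 < lilWeight x := zero_lt_one.trans_le (one_le_lilWeight x)

lemma continuous_lilWeight : Continuous lilWeight := by
  unfold lilWeight
  have h : ∀ x : ℝ, 1 ≤ Real.log (|x| + Real.exp 1) := fun x => one_le_log_add_exp (abs_nonneg x)
  have h1 : Continuous fun x : ℝ => Real.log (|x| + Real.exp 1) :=
    Continuous.log (by fun_prop) fun x => by positivity
  have h2 : Continuous fun x : ℝ => Real.log (Real.log (|x| + Real.exp 1)) :=
    h1.log fun x => by linarith [h x]
  fun_prop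

lemma lilWeight_mono {x y : ℝ} (h : |x| ≤ |y|) : lilWeight x ≤ lilWeight y := by
  refine Real.sqrt_le_sqrt ?_
  have h1 := logLog_mono (abs_nonneg x) h
  have h2 := mul_le_mul h h1 (logLog_nonneg (abs_nonneg x)) (abs_nonneg y)
  simp only [logLog] at h2
  linarith

/-- `x log log x` is doubling, up to an additive constant. -/
lemma exists_add_mul_logLog_le {S : ℝ} (hS : 0 ≤ S) :
    ∃ C : ℝ, 0 < C ∧ ∀ x : ℝ, 0 ≤ x → (x + S) * logLog (x + S) ≤ C * (1 + x * logLog x) := by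
  have hl1 : 0 < logLog 1 := logLog_pos one_pos
  have hlS : 0 ≤ logLog (1 + S) := logLog_nonneg (by linarith)
  have hl2 : 0 < Real.log 2 := Real.log_pos (by norm_num)
  set D : ℝ := (Real.log 2 + logLog (1 + S)) / logLog 1 + 1 with hD
  have hD0 : 0 < D := by positivity
  refine ⟨(1 + S) * logLog (1 + S) + (1 + S) * D, by positivity, fun x hx => ?_⟩
  have hlx := logLog_nonneg hx
  rcases le_total x 1 with h | h
  · have h1 : (x + S) * logLog (x + S) ≤ (1 + S) * logLog (1 + S) :=
      mul_le_mul (by linarith) (logLog_mono (by linarith) (by linarith))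
        (logLog_nonneg (by linarith)) (by linarith)
    have h2 : 0 ≤ (1 + S) * D := by positivity
    have h3 : 0 ≤ x * logLog x := mul_nonneg hx hlx
    have h4 : 0 ≤ (1 + S) * logLog (1 + S) := by positivity
    nlinarith
  · have h0 : x + S ≤ (1 + S) * x := by nlinarith
    have h1 : logLog (x + S) ≤ D * logLog x := by
      have h2 := (logLog_mono (by linarith) h0).trans (logLog_mul_le (by linarith) hx)
      have h3 : Real.log 2 + logLog (1 + S) ≤
          (Real.log 2 + logLog (1 + S)) / logLog 1 * logLog x := by
        rw [div_mul_eq_mul_div, le_div_iff₀ hl1]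
        exact mul_le_mul_of_nonneg_left (logLog_mono zero_le_one h) (by linarith)
      rw [hD, add_mul, one_mul]
      linarith
    have h2 : (x + S) * logLog (x + S) ≤ ((1 + S) * x) * (D * logLog x) :=
      mul_le_mul h0 h1 (logLog_nonneg (by linarith)) (by nlinarith)
    have h3 : 0 ≤ (1 + S) * logLog (1 + S) := by positivity
    have h4 : 0 ≤ x * logLog x := mul_nonneg hx hlx
    have h5 : 0 ≤ (1 + S) * D := by positivity
    nlinarith [mul_nonneg h3 h4]

/-- Passing from the lattice scale to the macroscopic scale costs `ε⁻¹ log log ε⁻¹` in the squared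
weight. -/
lemma exists_lilWeight_sq_le_scale {S : ℝ} (hS : 1 ≤ S) :
    ∃ C : ℝ, 0 < C ∧ ∀ ε ∈ Set.Ioo (0 : ℝ) (1 / 2), ∀ x y : ℝ, 0 ≤ y → ε * y ≤ |x| + S →
      lilWeight y ^ 2 ≤ C * (logLog (1 / ε) / ε) * lilWeight x ^ 2 := by
  obtain ⟨C, hC, h⟩ := exists_add_mul_logLog_le (zero_le_one.trans hS)
  have hl1 : 0 < logLog 1 := logLog_pos one_pos
  have hl2 : 0 < logLog 2 := logLog_pos two_pos
  have hln : 0 < Real.log 2 := Real.log_pos (by norm_num)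
  set D : ℝ := (1 + Real.log 2) / (logLog 1 * logLog 2) + 1 / logLog 2 + 1 / logLog 1 with hD
  have hD0 : 0 < D := by positivity
  refine ⟨D * C, by positivity, fun ε hε x y hy hxy => ?_⟩
  have hε0 := hε.1
  have hu : 1 ≤ |x| + S := by linarith [abs_nonneg x]
  set u := |x| + S with hudef
  have hlu : logLog 1 ≤ logLog u := logLog_mono zero_le_one hu
  have hεinv : 2 ≤ 1 / ε := by rw [le_div_iff₀ hε0]; linarith [hε.2]
  have hlε : logLog 2 ≤ logLog (1 / ε) := logLog_mono zero_le_two hεinv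
  set l := logLog (1 / ε)
  have hyu : y ≤ u * (1 / ε) := by
    rw [mul_one_div, le_div_iff₀ hε0]; linarith
  have hly : logLog y ≤ Real.log 2 + logLog u + l :=
    (logLog_mono hy hyu).trans (logLog_mul_le (by linarith) (by positivity))
  have hone : 1 ≤ u * (1 / ε) := by nlinarith
  have hstep : 1 + y * logLog y ≤ (u * (1 / ε)) * (1 + Real.log 2 + logLog u + l) := by
    have : y * logLog y ≤ (u * (1 / ε)) * (Real.log 2 + logLog u + l) :=
      mul_le_mul hyu hly (logLog_nonneg hy) (by linarith)
    linarith
  have hll : 0 < l := by linarith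
  have hlu0 : 0 < logLog u := by linarith
  have hDl : 1 + Real.log 2 + logLog u + l ≤ D * (logLog u * l) := by
    have e1 : 1 + Real.log 2 ≤ (1 + Real.log 2) / (logLog 1 * logLog 2) * (logLog u * l) := by
      rw [div_mul_eq_mul_div, le_div_iff₀ (by positivity)]
      exact mul_le_mul_of_nonneg_left (mul_le_mul hlu hlε hl2.le hlu0.le) (by positivity)
    have e2 : logLog u ≤ 1 / logLog 2 * (logLog u * l) := by
      rw [div_mul_eq_mul_div, le_div_iff₀ hl2, one_mul]
      exact mul_le_mul_of_nonneg_left hlε hlu0.le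
    have e3 : l ≤ 1 / logLog 1 * (logLog u * l) := by
      rw [div_mul_eq_mul_div, le_div_iff₀ hl1, one_mul, mul_comm]
      exact mul_le_mul_of_nonneg_right hlu hll.le
    rw [hD]
    linarith
  rw [lilWeight_sq, lilWeight_sq, abs_of_nonneg hy]
  calc 1 + y * logLog y ≤ (u * (1 / ε)) * (1 + Real.log 2 + logLog u + l) := hstep
    _ ≤ (u * (1 / ε)) * (D * (logLog u * l)) := mul_le_mul_of_nonneg_left hDl (by positivity)
    _ = D * (l / ε) * (u * logLog u) := by ring
    _ ≤ D * (l / ε) * (C * (1 + |x| * logLog |x|)) :=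
        mul_le_mul_of_nonneg_left (h |x| (abs_nonneg x)) (by positivity)
    _ = D * C * (l / ε) * (1 + |x| * logLog |x|) := by ring

/-! ### The upper half of the law of the iterated logarithm -/

section Walk

variable {Ω : Type*} [mΩ : MeasurableSpace Ω] {μ : Measure Ω} [IsProbabilityMeasure μ]

/-- The exponential of a centred random walk is a submartingale, since `𝔼[exp (s X)] ≥ 1` for
centred `X`. -/
lemma submartingale_exp_walk {X : ℕ → Ω → ℝ} (hX : ∀ i, Measurable (X i)) (hind : iIndepFun X μ)
    (s : ℝ) (hint : ∀ i, Integrable (fun ω => Real.exp (s * X i ω)) μ)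
    (hone : ∀ i, 1 ≤ ∫ ω, Real.exp (s * X i ω) ∂μ) :
    Submartingale (fun n ω => Real.exp (s * ∑ i ∈ Finset.range (n + 1), X i ω))
      (Filtration.natural X fun i => (hX i).stronglyMeasurable) μ := by
  have hSm : ∀ i, StronglyMeasurable (X i) := fun i => (hX i).stronglyMeasurable
  have hInt : ∀ n, Integrable (fun ω => Real.exp (s * ∑ i ∈ Finset.range (n + 1), X i ω)) μ := by
    intro n
    simpa [Finset.sum_apply] using
      hind.integrable_exp_mul_sum (t := s) hX (s := Finset.range (n + 1)) fun i _ => hint i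
  have hadp : StronglyAdapted (Filtration.natural X hSm)
      (fun n ω => Real.exp (s * ∑ i ∈ Finset.range (n + 1), X i ω)) := by
    intro n
    have hsum : StronglyMeasurable[Filtration.natural X hSm n]
        (fun ω => ∑ i ∈ Finset.range (n + 1), X i ω) :=
      Finset.stronglyMeasurable_fun_sum _ fun i hi =>
        (Filtration.stronglyAdapted_natural hSm).stronglyMeasurable_le
          (Nat.lt_succ_iff.mp (Finset.mem_range.mp hi))
    exact Real.continuous_exp.comp_stronglyMeasurable (hsum.const_mul s)
  refine submartingale_nat hadp hInt fun n => ?_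
  have hsplit : (fun ω => Real.exp (s * ∑ i ∈ Finset.range (n + 1 + 1), X i ω)) =
      (fun ω => Real.exp (s * ∑ i ∈ Finset.range (n + 1), X i ω)) *
        fun ω => Real.exp (s * X (n + 1) ω) := by
    funext ω
    simp only [Pi.mul_apply]
    rw [Finset.sum_range_succ _ (n + 1), mul_add, Real.exp_add]
  have hpull := condExp_mul_of_stronglyMeasurable_left (μ := μ) (hadp n)
    (hsplit ▸ hInt (n + 1)) (hint (n + 1))
  have hcond : μ[fun ω => Real.exp (s * X (n + 1) ω) | Filtration.natural X hSm n] =ᵐ[μ]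
      fun _ => ∫ ω, Real.exp (s * X (n + 1) ω) ∂μ :=
    condExp_indep_eq (hX (n + 1)).comap_le (Filtration.le _ n)
      (Real.continuous_exp.comp_stronglyMeasurable
        ((comap_measurable (X (n + 1))).stronglyMeasurable.const_mul s))
      (hind.indep_comap_natural_of_lt hSm (Nat.lt_succ_self n))
  rw [hsplit]
  filter_upwards [hpull, hcond] with ω h1 h2
  rw [h1, Pi.mul_apply, h2]
  exact le_mul_of_one_le_right (Real.exp_pos _).le (hone (n + 1))

/-- Maximal form of Hoeffding's inequality: Doob's inequality for `exp (s S)`, with the optimal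
`s = a / (n c)`. -/
lemma measure_exists_walk_ge_le {X : ℕ → Ω → ℝ} (hX : ∀ i, Measurable (X i))
    (hind : iIndepFun X μ) {c : NNReal} (hc : 0 < c) (hsub : ∀ i, HasSubgaussianMGF (X i) c μ)
    (hmean : ∀ i, ∫ ω, X i ω ∂μ = 0) (N : ℕ) {a : ℝ} (ha : 0 ≤ a) :
    μ {ω | ∃ n ≤ N, a ≤ ∑ i ∈ Finset.range (n + 1), X i ω} ≤
      ENNReal.ofReal (Real.exp (-a ^ 2 / (2 * ((N + 1 : ℝ) * c)))) := by
  have hcR : (0 : ℝ) < c := by exact_mod_cast hc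
  have hD : (0 : ℝ) < (N + 1 : ℝ) * c := by positivity
  set s : ℝ := a / ((N + 1 : ℝ) * c) with hs
  have hs0 : 0 ≤ s := by positivity
  have hint : ∀ i, Integrable (fun ω => Real.exp (s * X i ω)) μ :=
    fun i => (hsub i).integrable_exp_mul s
  have hone : ∀ i, 1 ≤ ∫ ω, Real.exp (s * X i ω) ∂μ := by
    intro i
    have h1 : ∫ ω, (s * X i ω + 1) ∂μ = 1 := by
      rw [integral_add ((hsub i).integrable.const_mul s) (integrable_const _),
        integral_const_mul, hmean i]
      simp
    rw [← h1]
    exact integral_mono (((hsub i).integrable.const_mul s).add (integrable_const _)) (hint i)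
      fun ω => Real.add_one_le_exp _
  have hsm := submartingale_exp_walk hX hind s hint hone
  have hmax := maximal_ineq hsm (fun n ω => (Real.exp_pos _).le)
    (ε := (Real.exp (s * a)).toNNReal) N
  rw [Real.coe_toNNReal _ (Real.exp_pos _).le] at hmax
  have hsubset : {ω | ∃ n ≤ N, a ≤ ∑ i ∈ Finset.range (n + 1), X i ω} ⊆
      {ω | Real.exp (s * a) ≤ (Finset.range (N + 1)).sup' Finset.nonempty_range_add_one
        fun k => Real.exp (s * ∑ i ∈ Finset.range (k + 1), X i ω)} := by
    rintro ω ⟨n, hn, hle⟩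
    refine le_trans ?_ (Finset.le_sup' (fun k => Real.exp (s * ∑ i ∈ Finset.range (k + 1), X i ω))
      (Finset.mem_range.mpr (Nat.lt_succ_of_le hn)))
    exact Real.exp_le_exp.mpr (mul_le_mul_of_nonneg_left hle hs0)
  have hmgf : ∫ ω, Real.exp (s * ∑ i ∈ Finset.range (N + 1), X i ω) ∂μ ≤
      Real.exp ((N + 1 : ℝ) * c * s ^ 2 / 2) := by
    have h := (HasSubgaussianMGF.sum_of_iIndepFun hind (c := fun _ => c)
      (s := Finset.range (N + 1)) fun i _ => hsub i).mgf_le s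
    simpa [mgf] using h
  have hfin : ENNReal.ofReal (Real.exp (s * a)) *
      μ {ω | ∃ n ≤ N, a ≤ ∑ i ∈ Finset.range (n + 1), X i ω} ≤
      ENNReal.ofReal (Real.exp ((N + 1 : ℝ) * c * s ^ 2 / 2)) := by
    refine (mul_le_mul_right (measure_mono hsubset) _).trans (hmax.trans ?_)
    refine ENNReal.ofReal_le_ofReal (le_trans ?_ hmgf)
    exact setIntegral_le_integral (hsm.integrable N)
      (Filter.Eventually.of_forall fun ω => (Real.exp_pos _).le)
  have hexp : Real.exp (-a ^ 2 / (2 * ((N + 1 : ℝ) * c))) =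
      Real.exp ((N + 1 : ℝ) * c * s ^ 2 / 2) / Real.exp (s * a) := by
    rw [← Real.exp_sub]
    congr 1
    rw [hs]
    field_simp
    ring
  rw [hexp, ENNReal.ofReal_div_of_pos (Real.exp_pos _)]
  rw [ENNReal.le_div_iff_mul_le (Or.inl (by simp [Real.exp_pos])) (Or.inl ENNReal.ofReal_ne_top)]
  rwa [mul_comm]

/-- One-sided law of the iterated logarithm on dyadic blocks: by the maximal inequality the walk
exceeds `2 √((2 ^ k + 1) c log (k + 1))` before time `2 ^ k` with probability at most
`(k + 1)⁻²`, so almost surely this happens for finitely many `k` only. -/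
lemma ae_eventually_walk_lt {X : ℕ → Ω → ℝ} (hX : ∀ i, Measurable (X i))
    (hind : iIndepFun X μ) {c : NNReal} (hc : 0 < c) (hsub : ∀ i, HasSubgaussianMGF (X i) c μ)
    (hmean : ∀ i, ∫ ω, X i ω ∂μ = 0) :
    ∀ᵐ ω ∂μ, ∀ᶠ k : ℕ in Filter.atTop, ∀ n ≤ 2 ^ k, ∑ i ∈ Finset.range (n + 1), X i ω <
      Real.sqrt (4 * ((2 ^ k + 1 : ℝ) * c) * Real.log (k + 1)) := by
  have hcR : (0 : ℝ) < c := by exact_mod_cast hc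
  have hsum : ∑' k : ℕ, μ {ω | ∃ n ≤ 2 ^ k, Real.sqrt (4 * ((2 ^ k + 1 : ℝ) * c) *
      Real.log (k + 1)) ≤ ∑ i ∈ Finset.range (n + 1), X i ω} ≠ ∞ := by
    have hb : ∀ k : ℕ, μ {ω | ∃ n ≤ 2 ^ k, Real.sqrt (4 * ((2 ^ k + 1 : ℝ) * c) *
        Real.log (k + 1)) ≤ ∑ i ∈ Finset.range (n + 1), X i ω} ≤
        ENNReal.ofReal (1 / ((k + 1 : ℕ) : ℝ) ^ 2) := by
      intro k
      refine (measure_exists_walk_ge_le hX hind hc hsub hmean (2 ^ k)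
        (Real.sqrt_nonneg _)).trans (ENNReal.ofReal_le_ofReal (le_of_eq ?_))
      have hlog : 0 ≤ Real.log (k + 1 : ℝ) := Real.log_nonneg (by linarith [k.cast_nonneg (α := ℝ)])
      rw [Real.sq_sqrt (by positivity)]
      have : -(4 * ((2 ^ k + 1 : ℝ) * c) * Real.log (k + 1)) /
          (2 * ((((2 ^ k : ℕ) : ℝ) + 1) * c)) = -(2 * Real.log (k + 1)) := by
        push_cast
        field_simp
        ring
      rw [this, Real.exp_neg, mul_comm, Real.exp_mul, Real.exp_log (by positivity)]
      push_cast
      norm_num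
    refine ne_top_of_le_ne_top ?_ (ENNReal.tsum_le_tsum hb)
    have hs : Summable fun k : ℕ => 1 / ((k + 1 : ℕ) : ℝ) ^ 2 :=
      (summable_nat_add_iff 1).mpr (Real.summable_one_div_nat_pow.mpr one_lt_two)
    rw [← ENNReal.ofReal_tsum_of_nonneg (fun k => by positivity) hs]
    exact ENNReal.ofReal_ne_top
  filter_upwards [ae_eventually_notMem hsum] with ω hω
  filter_upwards [hω] with k hk n hn
  by_contra hcon
  exact hk ⟨n, hn, not_lt.mp hcon⟩

/-- The dyadic level of `n ≥ 1` is comparable to `log n`. -/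
lemma log_natLog_add_le {n : ℕ} (hn : 1 ≤ n) :
    Real.log ((Nat.log 2 n + 1 : ℕ) + 1 : ℝ) ≤ Real.log 4 + logLog n := by
  have hn0 : (0 : ℝ) < n := by exact_mod_cast hn
  have h1 := one_le_log_add_exp hn0.le
  unfold logLog
  rw [← Real.log_mul (by norm_num) (by linarith)]
  refine Real.log_le_log (by positivity) ?_
  have h2 : (Nat.log 2 n : ℝ) * Real.log 2 ≤ Real.log (n + Real.exp 1) := by
    rw [← Real.log_pow]
    refine Real.log_le_log (by positivity) ?_
    have : ((2 ^ Nat.log 2 n : ℕ) : ℝ) ≤ n := by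
      exact_mod_cast Nat.pow_log_le_self 2 (by omega)
    push_cast at this
    linarith [Real.exp_pos 1]
  have h3 := Real.log_two_gt_d9
  have h4 : (0 : ℝ) ≤ Nat.log 2 n := Nat.cast_nonneg _
  push_cast
  nlinarith

/-- One-sided law of the iterated logarithm, without the sharp constant. -/
lemma ae_exists_walk_le {X : ℕ → Ω → ℝ} (hX : ∀ i, Measurable (X i))
    (hind : iIndepFun X μ) {c : NNReal} (hc : 0 < c) (hsub : ∀ i, HasSubgaussianMGF (X i) c μ)
    (hmean : ∀ i, ∫ ω, X i ω ∂μ = 0) :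
    ∀ᵐ ω ∂μ, ∃ C : ℝ, 0 ≤ C ∧ ∀ n : ℕ, ∑ i ∈ Finset.range n, X i ω ≤ C * lilWeight n := by
  filter_upwards [ae_eventually_walk_lt hX hind hc hsub hmean] with ω hω
  obtain ⟨K, hK⟩ := Filter.eventually_atTop.mp hω
  have hcR : (0 : ℝ) < c := by exact_mod_cast hc
  have hl1 : 0 < logLog 1 := logLog_pos one_pos
  have hl4 : 0 < Real.log 4 := Real.log_pos (by norm_num)
  set D : ℝ := Real.log 4 / logLog 1 + 1 with hD
  have hD0 : 0 < D := by positivity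
  set C₁ : ℝ := Real.sqrt (8 * c * D)
  set C₂ : ℝ := ∑ n ∈ Finset.range (2 ^ K + 2), |∑ i ∈ Finset.range n, X i ω|
  have hC₂ : 0 ≤ C₂ := Finset.sum_nonneg fun _ _ => abs_nonneg _
  refine ⟨C₁ + C₂, add_nonneg (Real.sqrt_nonneg _) hC₂, fun n => ?_⟩
  have hw := one_le_lilWeight n
  by_cases hn : n < 2 ^ K + 2
  · calc ∑ i ∈ Finset.range n, X i ω ≤ |∑ i ∈ Finset.range n, X i ω| := le_abs_self _
      _ ≤ C₂ := Finset.single_le_sum (f := fun n => |∑ i ∈ Finset.range n, X i ω|)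
          (fun _ _ => abs_nonneg _) (Finset.mem_range.mpr hn)
      _ ≤ (C₁ + C₂) * lilWeight n := by
          nlinarith [Real.sqrt_nonneg (8 * c * D)]
  · have hK1 : 1 ≤ 2 ^ K := Nat.one_le_two_pow
    obtain ⟨n, rfl⟩ : ∃ l, n = l + 1 := ⟨n - 1, by omega⟩
    have hKn : 2 ^ K ≤ n := by omega
    have hpos : 1 ≤ n := hK1.trans hKn
    have hnR : (1 : ℝ) ≤ n := by exact_mod_cast hpos
    set k := Nat.log 2 n + 1 with hk
    have hkK : K ≤ k := by
      have : K ≤ Nat.log 2 n := (Nat.le_log_iff_pow_le (by norm_num) (by omega)).mpr hKn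
      omega
    have hle : n ≤ 2 ^ k := (Nat.lt_pow_succ_log_self (by norm_num) n).le
    have hge : 2 ^ k ≤ 2 * n := by
      rw [hk, pow_succ, mul_comm]
      exact Nat.mul_le_mul_left 2 (Nat.pow_log_le_self 2 (by omega))
    have hgeR : (2 : ℝ) ^ k ≤ 2 * n := by exact_mod_cast hge
    have hlog : Real.log ((k : ℝ) + 1) ≤ D * logLog n := by
      have h1 := log_natLog_add_le hpos
      have h2 : Real.log 4 ≤ Real.log 4 / logLog 1 * logLog n := by
        rw [div_mul_eq_mul_div, le_div_iff₀ hl1]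
        exact mul_le_mul_of_nonneg_left (logLog_mono zero_le_one hnR) hl4.le
      rw [hD, add_mul, one_mul]
      linarith
    have hll : 0 ≤ logLog n := logLog_nonneg (by linarith)
    have hll' : logLog n ≤ logLog (n + 1 : ℝ) := logLog_mono (by linarith) (by linarith)
    refine (hK k hkK n hle).le.trans ?_
    refine le_trans (b := C₁ * lilWeight ((n + 1 : ℕ) : ℝ)) ?_ (by nlinarith)
    rw [show C₁ * lilWeight ((n + 1 : ℕ) : ℝ) = Real.sqrt (8 * c * D) * Real.sqrt
      (lilWeight ((n + 1 : ℕ) : ℝ) ^ 2) by rw [Real.sqrt_sq (lilWeight_pos _).le],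
      ← Real.sqrt_mul (by positivity), lilWeight_sq]
    refine Real.sqrt_le_sqrt ?_
    have hlog0 : 0 ≤ Real.log ((k : ℝ) + 1) :=
      Real.log_nonneg (by linarith [k.cast_nonneg (α := ℝ)])
    have habs : |((n + 1 : ℕ) : ℝ)| = n + 1 := by push_cast; exact abs_of_nonneg (by linarith)
    rw [habs]
    calc 4 * ((2 ^ k + 1) * (c : ℝ)) * Real.log (k + 1)
        ≤ 4 * ((2 * n + 2) * c) * (D * logLog (n + 1)) := by
          refine mul_le_mul ?_ (hlog.trans (mul_le_mul_of_nonneg_left hll' hD0.le)) hlog0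
            (by positivity)
          have := mul_le_mul_of_nonneg_right (show (2 : ℝ) ^ k + 1 ≤ 2 * n + 2 by linarith) hcR.le
          linarith
      _ = 8 * c * D * ((n + 1) * logLog (n + 1)) := by ring
      _ ≤ 8 * c * D * (1 + (n + 1) * logLog (n + 1)) :=
          mul_le_mul_of_nonneg_left (by linarith) (by positivity)

/-- The upper half of the law of the iterated logarithm, without the sharp constant, for bounded
centred independent steps. -/
theorem ae_exists_abs_walk_le {X : ℕ → Ω → ℝ} (hX : ∀ i, Measurable (X i))
    (hind : iIndepFun X μ) {a b : ℝ} (hab : a < b) (hbdd : ∀ i, ∀ᵐ ω ∂μ, X i ω ∈ Set.Icc a b)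
    (hmean : ∀ i, ∫ ω, X i ω ∂μ = 0) :
    ∀ᵐ ω ∂μ, ∃ C : ℝ, 0 ≤ C ∧ ∀ n : ℕ, |∑ i ∈ Finset.range n, X i ω| ≤ C * lilWeight n := by
  have hc : (0 : NNReal) < (‖b - a‖₊ / 2) ^ 2 := by
    have : 0 < ‖b - a‖₊ := nnnorm_pos.mpr (sub_ne_zero.mpr hab.ne')
    positivity
  have hsub : ∀ i, HasSubgaussianMGF (X i) ((‖b - a‖₊ / 2) ^ 2) μ := fun i =>
    hasSubgaussianMGF_of_mem_Icc_of_integral_eq_zero (hX i).aemeasurable (hbdd i) (hmean i)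
  have hneg := ae_exists_walk_le (X := fun i ω => -X i ω) (fun i => (hX i).neg)
    (hind.comp (fun _ x => -x) fun _ => measurable_neg) hc (fun i => (hsub i).neg)
    fun i => by rw [integral_neg, hmean i, neg_zero]
  filter_upwards [ae_exists_walk_le hX hind hc hsub hmean, hneg] with ω ⟨C, hC, h⟩ ⟨C', hC', h'⟩
  refine ⟨C + C', add_nonneg hC hC', fun n => abs_le.mpr ⟨?_, ?_⟩⟩
  · have h2 := h' n
    rw [Finset.sum_neg_distrib] at h2
    nlinarith [mul_nonneg hC (lilWeight_pos n).le]
  · nlinarith [h n, mul_nonneg hC' (lilWeight_pos n).le]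

end Walk

/-! ### Two-sided random walks -/

/-- The two-sided walk with increments `x`, vanishing at `0`. -/
noncomputable def intWalk (x : ℤ → ℝ) : ℤ → ℝ
  | Int.ofNat n => ∑ i ∈ Finset.range n, x i
  | Int.negSucc n => -∑ i ∈ Finset.range (n + 1), x (-((i : ℤ) + 1))

lemma intWalk_add_one_sub (x : ℤ → ℝ) (j : ℤ) : intWalk x (j + 1) - intWalk x j = x j := by
  rcases j with n | n
  · have : (Int.ofNat n + 1 : ℤ) = Int.ofNat (n + 1) := rfl
    rw [this]
    simp [intWalk, Finset.sum_range_succ]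
  · rcases n with _ | n
    · have : (Int.negSucc 0 + 1 : ℤ) = Int.ofNat 0 := rfl
      rw [this]
      simp [intWalk]
    · have : (Int.negSucc (n + 1) + 1 : ℤ) = Int.negSucc n := by
        rw [Int.negSucc_eq, Int.negSucc_eq]; push_cast; ring
      rw [this]
      simp only [intWalk]
      rw [Finset.sum_range_succ _ (n + 1)]
      rw [Int.negSucc_eq]
      push_cast
      ring

/-- A two-sided random walk with bounded centred independent steps grows at most like
`√(|j| log log |j|)`. -/
theorem ae_exists_abs_intWalk_le {Ω : Type*} [MeasurableSpace Ω] {μ : Measure Ω}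
    [IsProbabilityMeasure μ] {X : ℤ → Ω → ℝ} (hX : ∀ i, Measurable (X i))
    (hind : iIndepFun X μ) {a b : ℝ} (hab : a < b) (hbdd : ∀ i, ∀ᵐ ω ∂μ, X i ω ∈ Set.Icc a b)
    (hmean : ∀ i, ∫ ω, X i ω ∂μ = 0) :
    ∀ᵐ ω ∂μ, ∃ C : ℝ, 0 ≤ C ∧
      ∀ j : ℤ, |intWalk (fun i => X i ω) j| ≤ C * lilWeight j := by
  have h1 := ae_exists_abs_walk_le (X := fun n : ℕ => X n) (fun i => hX i)
    (hind.precomp Nat.cast_injective) hab (fun i => hbdd i) fun i => hmean i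
  have hinj : Function.Injective fun n : ℕ => -((n : ℤ) + 1) := fun m n h => by
    simp only [neg_inj, add_left_inj, Nat.cast_inj] at h
    exact h
  have h2 := ae_exists_abs_walk_le (X := fun n : ℕ => X (-((n : ℤ) + 1))) (fun i => hX _)
    (hind.precomp hinj) hab (fun i => hbdd _) fun i => hmean _
  filter_upwards [h1, h2] with ω ⟨C, hC, h⟩ ⟨C', hC', h'⟩
  refine ⟨C + C', add_nonneg hC hC', fun j => ?_⟩
  have hw := (lilWeight_pos j).le
  rcases j with n | n
  · have := h n
    simp only [intWalk]
    simp only [Int.ofNat_eq_natCast, Int.cast_natCast] at hw ⊢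
    nlinarith [mul_nonneg hC' hw]
  · have := h' (n + 1)
    simp only [intWalk, abs_neg]
    have habs : lilWeight ((Int.negSucc n : ℤ) : ℝ) = lilWeight ((n + 1 : ℕ) : ℝ) := by
      rw [Int.cast_negSucc]
      simp only [lilWeight, abs_neg]
    rw [habs] at hw ⊢
    nlinarith [mul_nonneg hC hw]

/-! ### Weak derivatives and continuous representatives -/

lemma integrable_mul_of_hasCompactSupport {u φ : ℝ → ℝ} (hu : LocallyIntegrable u volume)
    (hφ : Continuous φ) (hc : HasCompactSupport φ) : Integrable (fun x => u x * φ x) := by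
  have h := hu.integrable_smul_left_of_hasCompactSupport hφ hc
  simpa [mul_comm] using h

lemma exists_support_bound {φ : ℝ → ℝ} (hc : HasCompactSupport φ) :
    ∃ R : ℝ, 0 < R ∧ ∀ x, R ≤ |x| → φ x = 0 := by
  obtain ⟨R, hR, h⟩ := hc.isBounded.exists_pos_norm_lt
  refine ⟨R, hR, fun x hx => ?_⟩
  by_contra hne
  exact absurd (h x (subset_tsupport φ hne)) (not_lt.mpr hx)

lemma integral_eq_intervalIntegral_of_abs {f : ℝ → ℝ} {R : ℝ}
    (h : ∀ x, R ≤ |x| → f x = 0) : ∫ x, f x = ∫ x in (-R)..R, f x := by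
  refine (intervalIntegral.integral_eq_integral_of_support_subset fun x hx => ?_).symm
  by_contra hcon
  refine hx (h x ?_)
  rw [Set.mem_Ioc, not_and_or, not_lt, not_le] at hcon
  rcases hcon with h | h
  · exact le_trans (by linarith) (neg_le_abs x)
  · exact h.le.trans (le_abs_self x)

/-- A test function with vanishing integral is the derivative of a test function. -/
lemma exists_antideriv_of_integral_eq_zero {η : ℝ → ℝ} (hη : ContDiff ℝ (⊤ : ℕ∞) η)
    (hc : HasCompactSupport η) (h0 : ∫ x, η x = 0) :
    ∃ N : ℝ → ℝ, ContDiff ℝ (⊤ : ℕ∞) N ∧ HasCompactSupport N ∧ deriv N = η := by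
  obtain ⟨R, hR, hz⟩ := exists_support_bound hc
  have hd : ∀ x, HasDerivAt (fun x => ∫ t in (-R)..x, η t) (η x) x := fun x =>
    intervalIntegral.integral_hasDerivAt_right (hη.continuous.intervalIntegrable _ _)
      hη.continuous.stronglyMeasurable.stronglyMeasurableAtFilter hη.continuous.continuousAt
  have hderiv : deriv (fun x => ∫ t in (-R)..x, η t) = η := funext fun x => (hd x).deriv
  refine ⟨fun x => ∫ t in (-R)..x, η t, ?_, ?_, hderiv⟩
  · rw [contDiff_infty_iff_deriv, hderiv]
    exact ⟨fun x => (hd x).differentiableAt, hη⟩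
  · refine HasCompactSupport.of_support_subset_isCompact (isCompact_Icc (a := -R) (b := R)) ?_
    intro x hx
    by_contra hcon
    refine hx ?_
    rw [Set.mem_Icc, not_and_or, not_le, not_le] at hcon
    rcases hcon with h | h
    · refine intervalIntegral.integral_zero_ae (Filter.Eventually.of_forall fun t ht => hz t ?_)
      rw [Set.uIoc_of_ge h.le] at ht
      exact le_trans (by linarith [ht.2]) (neg_le_abs t)
    · have h1 : ∫ t in (-R)..R, η t = 0 := by rw [← integral_eq_intervalIntegral_of_abs hz, h0]
      have h2 : ∫ t in R..x, η t = 0 := by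
        refine intervalIntegral.integral_zero_ae (Filter.Eventually.of_forall fun t ht => hz t ?_)
        rw [Set.uIoc_of_le h.le] at ht
        exact ht.1.le.trans (le_abs_self t)
      beta_reduce
      rw [← intervalIntegral.integral_add_adjacent_intervals
        (hη.continuous.intervalIntegrable (-R) R) (hη.continuous.intervalIntegrable R x), h1, h2,
        add_zero]

/-- The lemma of du Bois-Reymond: a function with vanishing weak derivative is constant. -/
lemma exists_ae_eq_const_of_integral_mul_deriv {u : ℝ → ℝ} (hu : LocallyIntegrable u volume)
    (h : ∀ φ : ℝ → ℝ, ContDiff ℝ (⊤ : ℕ∞) φ → HasCompactSupport φ → ∫ x, u x * deriv φ x = 0) :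
    ∃ c : ℝ, u =ᵐ[volume] fun _ => c := by
  let f : ContDiffBump (0 : ℝ) := ⟨1, 2, one_pos, one_lt_two⟩
  set ψ : ℝ → ℝ := f.normed volume
  have hψ : ContDiff ℝ (⊤ : ℕ∞) ψ := f.contDiff_normed
  have hψc : HasCompactSupport ψ := f.hasCompactSupport_normed
  have hψ1 : ∫ x, ψ x = 1 := f.integral_normed
  refine ⟨∫ x, u x * ψ x, ?_⟩
  refine ae_eq_of_integral_contDiff_smul_eq hu (locallyIntegrable_const _) fun φ hφ hφc => ?_
  have hiφ : Integrable φ := hφ.continuous.integrable_of_hasCompactSupport hφc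
  have hiψ : Integrable ψ := hψ.continuous.integrable_of_hasCompactSupport hψc
  obtain ⟨N, hN, hNc, hNd⟩ := exists_antideriv_of_integral_eq_zero
    (η := fun x => φ x - (∫ y, φ y) * ψ x) (hφ.sub (contDiff_const.mul hψ))
    (hφc.sub hψc.mul_left) (by
      rw [integral_sub hiφ (hiψ.const_mul _), integral_const_mul, hψ1, mul_one, sub_self])
  have h0 := h N hN hNc
  rw [hNd] at h0
  have h1 : ∫ x, u x * (φ x - (∫ y, φ y) * ψ x) =
      (∫ x, u x * φ x) - (∫ y, φ y) * ∫ x, u x * ψ x := by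
    rw [← integral_const_mul, ← integral_sub
      (integrable_mul_of_hasCompactSupport hu hφ.continuous hφc)
      ((integrable_mul_of_hasCompactSupport hu hψ.continuous hψc).const_mul _)]
    congr 1
    funext x
    ring
  rw [h1, sub_eq_zero] at h0
  simp only [smul_eq_mul]
  rw [integral_mul_const, ← h0]
  congr 1
  funext x
  ring

/-- A function with locally integrable weak derivative `G` is almost everywhere a primitive of
`G`. -/
lemma IsWeakDeriv.exists_ae_eq_primitive {F G : ℝ → ℝ} (h : IsWeakDeriv 1 F G) :
    ∃ c : ℝ, F =ᵐ[volume] fun x => c + ∫ t in (0 : ℝ)..x, G t := by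
  have hGi : ∀ a b : ℝ, IntervalIntegrable G volume a b := fun a b =>
    (h.locallyIntegrable_right.integrableOn_isCompact isCompact_uIcc).intervalIntegrable
  have hHc : Continuous fun x => ∫ t in (0 : ℝ)..x, G t :=
    intervalIntegral.continuous_primitive hGi 0
  have hu : LocallyIntegrable (fun x => F x - ∫ t in (0 : ℝ)..x, G t) volume :=
    h.locallyIntegrable_left.sub hHc.locallyIntegrable
  obtain ⟨c, hc⟩ := exists_ae_eq_const_of_integral_mul_deriv hu fun φ hφ hφc => by
    have hdφ : ContDiff ℝ (⊤ : ℕ∞) (deriv φ) := (contDiff_infty_iff_deriv.mp hφ).2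
    have hw := h.integral_eq φ hφ hφc
    rw [iteratedDeriv_one] at hw
    obtain ⟨R, hR, hz⟩ := exists_support_bound hφc
    obtain ⟨R', hR', hz'⟩ := exists_support_bound hφc.deriv
    set M := max R R'
    have hφM : ∀ x, M ≤ |x| → φ x = 0 := fun x hx => hz x ((le_max_left _ _).trans hx)
    have hdM : ∀ x, M ≤ |x| → deriv φ x = 0 := fun x hx => hz' x ((le_max_right _ _).trans hx)
    have hM : 0 < M := hR.trans_le (le_max_left _ _)
    have hac1 : AbsolutelyContinuousOnInterval (fun x => ∫ t in (0 : ℝ)..x, G t) (-M) M :=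
      (hGi (-M) M).absolutelyContinuousOnInterval_intervalIntegral
        (by rw [Set.uIcc_of_le (by linarith)]; exact ⟨by linarith, hM.le⟩)
    have hac2 : AbsolutelyContinuousOnInterval φ (-M) M :=
      ContDiffOn.absolutelyContinuousOnInterval
        ((hφ.of_le (by exact_mod_cast le_top)).contDiffOn)
    have hparts := hac1.integral_mul_deriv_eq_deriv_mul hac2
    rw [hφM M (le_abs_self M), hφM (-M) (by rw [abs_neg]; exact le_abs_self M)] at hparts
    have hcongr : ∫ x in (-M)..M, deriv (fun x => ∫ t in (0 : ℝ)..x, G t) x * φ x =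
        ∫ x in (-M)..M, G x * φ x := by
      refine intervalIntegral.integral_congr_ae ?_
      filter_upwards [_root_.LocallyIntegrable.ae_hasDerivAt_integral h.locallyIntegrable_right] with x hx _
      rw [(hx 0).deriv]
    rw [hcongr, ← integral_eq_intervalIntegral_of_abs (fun x hx => by rw [hdM x hx, mul_zero]),
      ← integral_eq_intervalIntegral_of_abs (fun x hx => by rw [hφM x hx, mul_zero])] at hparts
    simp_rw [sub_mul]
    rw [integral_sub (integrable_mul_of_hasCompactSupport h.locallyIntegrable_left
      hdφ.continuous hφc.deriv) (integrable_mul_of_hasCompactSupport hHc.locallyIntegrable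
      hdφ.continuous hφc.deriv), hw, hparts]
    ring
  refine ⟨c, ?_⟩
  filter_upwards [hc] with x hx
  linarith

lemma IsWeakDeriv.ae_unique {i : ℕ} {F G G' : ℝ → ℝ} (h : IsWeakDeriv i F G)
    (h' : IsWeakDeriv i F G') : G =ᵐ[volume] G' := by
  refine ae_eq_of_integral_contDiff_smul_eq h.locallyIntegrable_right h'.locallyIntegrable_right
    fun φ hφ hφc => ?_
  have h1 := (h.integral_eq φ hφ hφc).symm.trans (h'.integral_eq φ hφ hφc)
  have h2 : (-1 : ℝ) ^ i ≠ 0 := pow_ne_zero _ (by norm_num)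
  simpa [mul_comm] using mul_left_cancel₀ h2 h1

lemma IsWeakDeriv.of_succ {i : ℕ} {F G G' : ℝ → ℝ} (h : IsWeakDeriv i F G)
    (h' : IsWeakDeriv (i + 1) F G') : IsWeakDeriv 1 G G' where
  locallyIntegrable_left := h.locallyIntegrable_right
  locallyIntegrable_right := h'.locallyIntegrable_right
  integral_eq φ hφ hφc := by
    have h1 := h.integral_eq (deriv φ) (contDiff_infty_iff_deriv.mp hφ).2 hφc.deriv
    have h2 := h'.integral_eq φ hφ hφc
    rw [iteratedDeriv_succ', h1, pow_succ, mul_assoc] at h2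
    rw [iteratedDeriv_one, pow_one]
    exact mul_left_cancel₀ (pow_ne_zero i (by norm_num)) h2

lemma isWeakDeriv_zero {F : ℝ → ℝ} (hF : Continuous F) : IsWeakDeriv 0 F F :=
  ⟨hF.locallyIntegrable, hF.locallyIntegrable, fun φ _ _ => by simp⟩

lemma iInf_isWeakDeriv_eq {i : ℕ} {F G : ℝ → ℝ} (h : IsWeakDeriv i F G) :
    ⨅ (G' : ℝ → ℝ) (_ : IsWeakDeriv i F G'), eLpNorm (fun x => lilWeight x * G' x) 2 volume =
      eLpNorm (fun x => lilWeight x * G x) 2 volume := by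
  refine le_antisymm (iInf₂_le G h) (le_iInf₂ fun G' h' => le_of_eq (eLpNorm_congr_ae ?_))
  filter_upwards [h.ae_unique h'] with x hx
  rw [hx]

/-- Functions of the weighted Sobolev space are twice continuously differentiable, with locally
absolutely continuous second derivative, and their norm is that of their classical derivatives. -/
theorem MemHLil.exists_derivs {F : ℝ → ℝ} (h : MemHLil 3 F) :
    ∃ F₁ F₂ F₃ : ℝ → ℝ, (∀ x, HasDerivAt F (F₁ x) x) ∧ (∀ x, HasDerivAt F₁ (F₂ x) x) ∧
      Continuous F₂ ∧ LocallyIntegrable F₃ volume ∧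
      (∀ x y, F₂ y - F₂ x = ∫ t in x..y, F₃ t) ∧
      lilNorm 3 F = eLpNorm (fun x => lilWeight x * F x) 2 volume +
        eLpNorm (fun x => lilWeight x * F₁ x) 2 volume +
        eLpNorm (fun x => lilWeight x * F₂ x) 2 volume +
        eLpNorm (fun x => lilWeight x * F₃ x) 2 volume := by
  have hex : ∀ i ∈ Finset.range (3 + 1), ∃ G, IsWeakDeriv i F G := by
    intro i hi
    have hlt := ENNReal.sum_lt_top.mp h.lilNorm_lt_top i hi
    obtain ⟨G, hG⟩ := iInf_lt_iff.mp hlt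
    obtain ⟨hG, -⟩ := iInf_lt_iff.mp hG
    exact ⟨G, hG⟩
  obtain ⟨G₁, h1⟩ := hex 1 (by simp)
  obtain ⟨G₂, h2⟩ := hex 2 (by simp)
  obtain ⟨G₃, h3⟩ := hex 3 (by simp)
  have h0 := isWeakDeriv_zero h.continuous
  have hii : ∀ a b : ℝ, IntervalIntegrable G₃ volume a b := fun a b =>
    (h3.locallyIntegrable_right.integrableOn_isCompact isCompact_uIcc).intervalIntegrable
  obtain ⟨c₂, hc2⟩ := (h2.of_succ h3).exists_ae_eq_primitive
  obtain ⟨c₁, hc1⟩ := (h1.of_succ h2).exists_ae_eq_primitive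
  obtain ⟨c₀, hc0⟩ := (h0.of_succ h1).exists_ae_eq_primitive
  set F₂ : ℝ → ℝ := fun x => c₂ + ∫ t in (0 : ℝ)..x, G₃ t with hF2
  have hF2c : Continuous F₂ := continuous_const.add (intervalIntegral.continuous_primitive hii 0)
  set F₁ : ℝ → ℝ := fun x => c₁ + ∫ t in (0 : ℝ)..x, F₂ t with hF1
  have hd1 : ∀ x, HasDerivAt F₁ (F₂ x) x := fun x =>
    (intervalIntegral.integral_hasDerivAt_right (hF2c.intervalIntegrable _ _)
      hF2c.stronglyMeasurable.stronglyMeasurableAtFilter hF2c.continuousAt).const_add c₁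
  have hF1c : Continuous F₁ := continuous_iff_continuousAt.mpr fun x => (hd1 x).continuousAt
  have hG1 : G₁ =ᵐ[volume] F₁ := by
    filter_upwards [hc1] with x hx
    rw [hx, hF1]
    congr 1
    exact intervalIntegral.integral_congr_ae (hc2.mono fun t ht _ => ht)
  set P : ℝ → ℝ := fun x => c₀ + ∫ t in (0 : ℝ)..x, F₁ t with hP
  have hd0 : ∀ x, HasDerivAt P (F₁ x) x := fun x =>
    (intervalIntegral.integral_hasDerivAt_right (hF1c.intervalIntegrable _ _)
      hF1c.stronglyMeasurable.stronglyMeasurableAtFilter hF1c.continuousAt).const_add c₀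
  have hPc : Continuous P := continuous_iff_continuousAt.mpr fun x => (hd0 x).continuousAt
  have hFP : F = P := by
    refine (Continuous.ae_eq_iff_eq volume h.continuous hPc).mp ?_
    filter_upwards [hc0] with x hx
    rw [hx, hP]
    congr 1
    exact intervalIntegral.integral_congr_ae (hG1.mono fun t ht _ => ht)
  refine ⟨F₁, F₂, G₃, fun x => hFP ▸ hd0 x, hd1, hF2c, h3.locallyIntegrable_right, fun x y => ?_, ?_⟩
  · simp only [hF2]
    rw [← intervalIntegral.integral_interval_sub_left (hii 0 y) (hii 0 x)]
    ring
  · have e1 : eLpNorm (fun x => lilWeight x * G₁ x) 2 volume =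
        eLpNorm (fun x => lilWeight x * F₁ x) 2 volume :=
      eLpNorm_congr_ae (hG1.mono fun x hx => by simp only [hx])
    have e2 : eLpNorm (fun x => lilWeight x * G₂ x) 2 volume =
        eLpNorm (fun x => lilWeight x * F₂ x) 2 volume :=
      eLpNorm_congr_ae (hc2.mono fun x hx => by simp only [hx])
    rw [lilNorm, Finset.sum_range_succ, Finset.sum_range_succ, Finset.sum_range_succ,
      Finset.sum_range_one, iInf_isWeakDeriv_eq h0, iInf_isWeakDeriv_eq h1,
      iInf_isWeakDeriv_eq h2, iInf_isWeakDeriv_eq h3, e1, e2]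

/-! ### Sampling functions of the weighted Sobolev space -/

lemma enorm_add_sq_le (a b : ℝ≥0∞) : (a + b) ^ 2 ≤ 2 * (a ^ 2 + b ^ 2) := by
  have h := ENNReal.rpow_add_le_mul_rpow_add_rpow a b (p := 2) one_le_two
  have e : (2 : ℝ) - 1 = 1 := by norm_num
  rw [e, ENNReal.rpow_one] at h
  simpa only [ENNReal.rpow_two] using h

lemma eLpNorm_two_sq {α : Type*} [MeasurableSpace α] {ν : Measure α} (f : α → ℝ) :
    eLpNorm f 2 ν ^ 2 = ∫⁻ x, ‖f x‖ₑ ^ 2 ∂ν := by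
  rw [eLpNorm_eq_lintegral_rpow_enorm_toReal (by norm_num) (by norm_num)]
  simp only [ENNReal.toReal_ofNat, ENNReal.rpow_two]
  rw [← ENNReal.rpow_two, ← ENNReal.rpow_mul]
  norm_num

lemma lintegral_sq_le_of_isProbabilityMeasure {α : Type*} [MeasurableSpace α] {ν : Measure α}
    [IsProbabilityMeasure ν] {G : α → ℝ} (hG : AEStronglyMeasurable G ν) :
    (∫⁻ x, ‖G x‖ₑ ∂ν) ^ 2 ≤ ∫⁻ x, ‖G x‖ₑ ^ 2 ∂ν := by
  rw [← eLpNorm_two_sq, ← eLpNorm_one_eq_lintegral_enorm]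
  gcongr
  exact eLpNorm_le_eLpNorm_of_exponent_le one_le_two hG

/-- Sobolev's inequality on a unit interval. -/
lemma enorm_sq_le_lintegral_Icc {F G : ℝ → ℝ} (hF : Continuous F)
    (hG : LocallyIntegrable G volume) (h : ∀ x y, F y - F x = ∫ t in x..y, G t) (x : ℝ) :
    ‖F x‖ₑ ^ 2 ≤ 2 * ∫⁻ y in Set.Icc x (x + 1), (‖F y‖ₑ ^ 2 + ‖G y‖ₑ ^ 2) := by
  set ν : Measure ℝ := volume.restrict (Set.Icc x (x + 1)) with hν
  have hprob : IsProbabilityMeasure ν := ⟨by simp [hν]⟩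
  have hpt : ∀ y ∈ Set.Icc x (x + 1), ‖F x‖ₑ ≤ ‖F y‖ₑ + ∫⁻ t, ‖G t‖ₑ ∂ν := by
    intro y hy
    have h1 : F x = F y - ∫ t in x..y, G t := by rw [← h x y]; ring
    calc ‖F x‖ₑ = ‖F y - ∫ t in x..y, G t‖ₑ := by rw [← h1]
      _ ≤ ‖F y‖ₑ + ‖∫ t in x..y, G t‖ₑ := enorm_sub_le
      _ ≤ ‖F y‖ₑ + ∫⁻ t, ‖G t‖ₑ ∂ν := by
        gcongr
        rw [intervalIntegral.integral_of_le hy.1]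
        refine (enorm_integral_le_lintegral_enorm _).trans (lintegral_mono_set fun t ht => ?_)
        exact ⟨ht.1.le, ht.2.trans hy.2⟩
  have hsq : ∀ y ∈ Set.Icc x (x + 1), ‖F x‖ₑ ^ 2 ≤ 2 * (‖F y‖ₑ ^ 2 + ∫⁻ t, ‖G t‖ₑ ^ 2 ∂ν) := by
    intro y hy
    calc ‖F x‖ₑ ^ 2 ≤ (‖F y‖ₑ + ∫⁻ t, ‖G t‖ₑ ∂ν) ^ 2 := by gcongr; exact hpt y hy
      _ ≤ 2 * (‖F y‖ₑ ^ 2 + (∫⁻ t, ‖G t‖ₑ ∂ν) ^ 2) := enorm_add_sq_le _ _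
      _ ≤ 2 * (‖F y‖ₑ ^ 2 + ∫⁻ t, ‖G t‖ₑ ^ 2 ∂ν) := by
        gcongr
        exact lintegral_sq_le_of_isProbabilityMeasure hG.aestronglyMeasurable.restrict
  calc ‖F x‖ₑ ^ 2 = ∫⁻ _, ‖F x‖ₑ ^ 2 ∂ν := by simp
    _ ≤ ∫⁻ y, 2 * (‖F y‖ₑ ^ 2 + ∫⁻ t, ‖G t‖ₑ ^ 2 ∂ν) ∂ν :=
        setLIntegral_mono' measurableSet_Icc hsq
    _ = 2 * ∫⁻ y, (‖F y‖ₑ ^ 2 + ‖G y‖ₑ ^ 2) ∂ν := by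
        rw [lintegral_const_mul' _ _ (by norm_num),
          lintegral_add_left (hF.measurable.enorm.pow_const 2),
          lintegral_add_left (hF.measurable.enorm.pow_const 2)]
        simp

/-- The windows of macroscopic length `2 S + 1` around the lattice points cover a given point at
most `(2 S + 2) / ε` times, and the weight `ρ²` at the lattice points involved is at most
`ε⁻¹ log log ε⁻¹` times the macroscopic weight. -/
lemma exists_tsum_window_le {ρ : ℤ → ℝ} {K : ℝ} (hρ : ∀ j, |ρ j| ≤ K * lilWeight (|(j : ℝ)| + 1))
    {S : ℝ} (hS : 0 ≤ S) :
    ∃ C : ℝ, 0 < C ∧ ∀ ε ∈ Set.Ioo (0 : ℝ) (1 / 2), ∀ g : ℝ → ℝ≥0∞, AEMeasurable g volume →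
      ∑' j : ℤ, ENNReal.ofReal (ρ j ^ 2) * ∫⁻ x in Set.Icc (ε * j - S) (ε * j + S + 1), g x ≤
        ENNReal.ofReal (C * (logLog (1 / ε) / ε ^ 2)) *
          ∫⁻ x, ENNReal.ofReal (lilWeight x ^ 2) * g x := by
  obtain ⟨C, hC, h⟩ := exists_lilWeight_sq_le_scale (S := S + 2) (by linarith)
  refine ⟨(2 * S + 2) * ((K ^ 2 + 1) * C), by positivity, fun ε hε g hg => ?_⟩
  have hε0 := hε.1
  have hl : 0 ≤ logLog (1 / ε) := logLog_nonneg (by positivity)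
  have hswap : ∑' j : ℤ, ENNReal.ofReal (ρ j ^ 2) *
      ∫⁻ x in Set.Icc (ε * j - S) (ε * j + S + 1), g x =
      ∫⁻ x, ∑' j : ℤ, ENNReal.ofReal (ρ j ^ 2) *
        (Set.Icc (ε * j - S) (ε * j + S + 1)).indicator g x := by
    rw [lintegral_tsum fun j => (hg.indicator measurableSet_Icc).const_mul _]
    refine tsum_congr fun j => ?_
    rw [lintegral_const_mul' _ _ ENNReal.ofReal_ne_top, lintegral_indicator measurableSet_Icc]
  rw [hswap, ← lintegral_const_mul' _ _ ENNReal.ofReal_ne_top]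
  refine lintegral_mono fun x => ?_
  set s : Finset ℤ := Finset.Icc ⌈(x - S - 1) / ε⌉ ⌊(x + S) / ε⌋ with hs
  have hmem : ∀ j : ℤ, x ∈ Set.Icc (ε * j - S) (ε * j + S + 1) → j ∈ s := by
    intro j hj
    rw [hs, Finset.mem_Icc, Int.ceil_le, Int.le_floor, div_le_iff₀ hε0, le_div_iff₀ hε0]
    constructor <;> linarith [hj.1, hj.2, mul_comm ε (j : ℝ)]
  have hcard : (s.card : ℝ) ≤ (2 * S + 2) / ε := by
    rw [hs, Int.card_Icc]
    have h0 : (0 : ℝ) ≤ (2 * S + 2) / ε := by positivity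
    have h1 : ((⌊(x + S) / ε⌋ + 1 - ⌈(x - S - 1) / ε⌉ : ℤ) : ℝ) ≤ (2 * S + 2) / ε := by
      have e1 := Int.floor_le ((x + S) / ε)
      have e2 := Int.le_ceil ((x - S - 1) / ε)
      have e3 : (x + S) / ε + 1 - (x - S - 1) / ε ≤ (2 * S + 2) / ε := by
        rw [div_add_one hε0.ne', ← sub_div, div_le_div_iff_of_pos_right hε0]
        linarith [hε.2]
      push_cast
      linarith
    rcases le_total 0 (⌊(x + S) / ε⌋ + 1 - ⌈(x - S - 1) / ε⌉) with h2 | h2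
    · have : (((⌊(x + S) / ε⌋ + 1 - ⌈(x - S - 1) / ε⌉).toNat : ℤ) : ℝ) ≤ (2 * S + 2) / ε := by
        rw [Int.toNat_of_nonneg h2]; exact h1
      exact_mod_cast this
    · rw [Int.toNat_of_nonpos h2]; simpa using h0
  set W : ℝ := (K ^ 2 + 1) * C * (logLog (1 / ε) / ε) * lilWeight x ^ 2 with hW
  have hW0 : 0 ≤ W := by positivity
  have hterm : ∀ j : ℤ, ENNReal.ofReal (ρ j ^ 2) *
      (Set.Icc (ε * j - S) (ε * j + S + 1)).indicator g x ≤ ENNReal.ofReal W * g x := by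
    intro j
    by_cases hj : x ∈ Set.Icc (ε * j - S) (ε * j + S + 1)
    · rw [Set.indicator_of_mem hj]
      gcongr
      have hy : ε * (|(j : ℝ)| + 1) ≤ |x| + (S + 2) := by
        have e1 : ε * |(j : ℝ)| = |ε * j| := by rw [abs_mul, abs_of_pos hε0]
        have e2 : |ε * j| ≤ |x| + (S + 1) := by
          rw [abs_le]
          constructor <;> linarith [hj.1, hj.2, neg_abs_le x, le_abs_self x]
        linarith [hε.2]
      have h1 := h ε hε x (|(j : ℝ)| + 1) (by positivity) hy
      have h2 : ρ j ^ 2 ≤ K ^ 2 * lilWeight (|(j : ℝ)| + 1) ^ 2 := by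
        rw [← sq_abs, ← mul_pow]
        exact pow_le_pow_left₀ (abs_nonneg _) (hρ j) 2
      calc ρ j ^ 2 ≤ K ^ 2 * lilWeight (|(j : ℝ)| + 1) ^ 2 := h2
        _ ≤ (K ^ 2 + 1) * lilWeight (|(j : ℝ)| + 1) ^ 2 := by gcongr; linarith
        _ ≤ (K ^ 2 + 1) * (C * (logLog (1 / ε) / ε) * lilWeight x ^ 2) := by gcongr
        _ = W := by rw [hW]; ring
    · rw [Set.indicator_of_notMem hj, mul_zero]; exact zero_le
  rw [tsum_eq_sum (s := s) fun j hj => by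
    rw [Set.indicator_of_notMem fun hx => hj (hmem j hx), mul_zero]]
  calc ∑ j ∈ s, ENNReal.ofReal (ρ j ^ 2) * (Set.Icc (ε * j - S) (ε * j + S + 1)).indicator g x
      ≤ ∑ _j ∈ s, ENNReal.ofReal W * g x := Finset.sum_le_sum fun j _ => hterm j
    _ = ENNReal.ofReal (s.card * W) * g x := by
        rw [Finset.sum_const, nsmul_eq_mul, ENNReal.ofReal_mul (Nat.cast_nonneg _),
          ENNReal.ofReal_natCast, mul_assoc]
    _ ≤ ENNReal.ofReal ((2 * S + 2) / ε * W) * g x := by gcongr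
    _ = _ := by
        have e : (2 * S + 2) / ε * W =
            (2 * S + 2) * ((K ^ 2 + 1) * C) * (logLog (1 / ε) / ε ^ 2) * lilWeight x ^ 2 := by
          rw [hW]
          field_simp
        rw [e, ENNReal.ofReal_mul (by positivity), mul_assoc]

/-- Lattice samples of a function of the weighted Sobolev space and of its first two derivatives,
shifted by at most `S`, are dominated by one sequence `D`. Against a weight `ρ` that grows like a
random walk, the `ℓ²` norm of `D` is of order `ε⁻¹ √(log log ε⁻¹)`. -/
theorem exists_sample_majorant {ρ : ℤ → ℝ} {K : ℝ} (hρ1 : ∀ j, 1 ≤ ρ j)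
    (hρ : ∀ j, |ρ j| ≤ K * lilWeight (|(j : ℝ)| + 1)) {S : ℝ} (hS : 0 ≤ S) :
    ∃ C : ℝ, 0 < C ∧ ∀ F : ℝ → ℝ, MemHLil 3 F → ∃ F₁ F₂ : ℝ → ℝ,
      (∀ x, HasDerivAt F (F₁ x) x) ∧ (∀ x, HasDerivAt F₁ (F₂ x) x) ∧
      ∀ ε ∈ Set.Ioo (0 : ℝ) (1 / 2), ∃ D : ℤ → ℝ, (∀ j, 0 ≤ D j) ∧
        (∀ (j : ℤ) (s : ℝ), |s| ≤ S → |F (ε * j + s)| ≤ D j ∧ |F₁ (ε * j + s)| ≤ D j ∧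
          |F₂ (ε * j + s)| ≤ D j) ∧
        ∑' j : ℤ, ENNReal.ofReal ((ρ j * D j) ^ 2) ≤
          ENNReal.ofReal (C * (logLog (1 / ε) / ε ^ 2) * (lilNorm 3 F).toReal ^ 2) := by
  obtain ⟨C, hC, h⟩ := exists_tsum_window_le hρ hS
  refine ⟨4 * C, by positivity, fun F hF => ?_⟩
  obtain ⟨F₁, F₂, F₃, hd1, hd2, hF2, hF3, hint, hnorm⟩ := hF.exists_derivs
  refine ⟨F₁, F₂, hd1, hd2, fun ε hε => ?_⟩
  have hF1 : Continuous F₁ := continuous_iff_continuousAt.mpr fun x => (hd2 x).continuousAt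
  have hε0 := hε.1
  have hl : 0 ≤ logLog (1 / ε) := logLog_nonneg (by positivity)
  set g : ℝ → ℝ≥0∞ := fun x => ‖F x‖ₑ ^ 2 + ‖F₁ x‖ₑ ^ 2 + ‖F₂ x‖ₑ ^ 2 + ‖F₃ x‖ₑ ^ 2 with hg
  have hmF : AEMeasurable (fun x => ‖F x‖ₑ ^ 2) volume :=
    (hF.continuous.measurable.enorm.pow_const 2).aemeasurable
  have hm1 : AEMeasurable (fun x => ‖F₁ x‖ₑ ^ 2) volume :=
    (hF1.measurable.enorm.pow_const 2).aemeasurable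
  have hm2 : AEMeasurable (fun x => ‖F₂ x‖ₑ ^ 2) volume :=
    (hF2.measurable.enorm.pow_const 2).aemeasurable
  have hm3 : AEMeasurable (fun x => ‖F₃ x‖ₑ ^ 2) volume :=
    hF3.aestronglyMeasurable.enorm.pow_const 2
  have hgm : AEMeasurable g volume := ((hmF.add hm1).add hm2).add hm3
  have hweight : ∀ G : ℝ → ℝ, ∫⁻ x, ENNReal.ofReal (lilWeight x ^ 2) * ‖G x‖ₑ ^ 2 =
      eLpNorm (fun x => lilWeight x * G x) 2 volume ^ 2 := by
    intro G
    rw [eLpNorm_two_sq]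
    refine lintegral_congr fun x => ?_
    rw [enorm_mul, mul_pow, Real.enorm_of_nonneg (lilWeight_pos x).le,
      ENNReal.ofReal_pow (lilWeight_pos x).le]
  have hwm : AEMeasurable (fun x => ENNReal.ofReal (lilWeight x ^ 2)) volume :=
    (continuous_lilWeight.pow 2).measurable.ennreal_ofReal.aemeasurable
  have htotal : ∫⁻ x, ENNReal.ofReal (lilWeight x ^ 2) * g x ≤ lilNorm 3 F ^ 2 := by
    simp only [hg, mul_add]
    have hm : ∀ G : ℝ → ℝ, AEMeasurable (fun x => ‖G x‖ₑ ^ 2) volume →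
        AEMeasurable (fun x => ENNReal.ofReal (lilWeight x ^ 2) * ‖G x‖ₑ ^ 2) volume :=
      fun G hG => hwm.mul hG
    rw [lintegral_add_right' _ (hm _ hm3), lintegral_add_right' _ (hm _ hm2),
      lintegral_add_right' _ (hm _ hm1), hweight, hweight, hweight, hweight, hnorm]
    have key : ∀ a b : ℝ≥0∞, a ^ 2 + b ^ 2 ≤ (a + b) ^ 2 := fun a b => by
      rw [add_sq]
      calc a ^ 2 + b ^ 2 ≤ a ^ 2 + b ^ 2 + 2 * a * b := le_self_add
        _ = _ := by ring
    refine le_trans ?_ (key _ _)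
    gcongr
    refine le_trans ?_ (key _ _)
    gcongr
    exact key _ _
  have hfin : lilNorm 3 F ≠ ∞ := hF.lilNorm_lt_top.ne
  set d : ℤ → ℝ≥0∞ := fun j => 2 * ∫⁻ x in Set.Icc (ε * j - S) (ε * j + S + 1), g x with hd
  have hdsum : ∑' j : ℤ, ENNReal.ofReal (ρ j ^ 2) * d j ≤
      ENNReal.ofReal (4 * C * (logLog (1 / ε) / ε ^ 2) * (lilNorm 3 F).toReal ^ 2) := by
    have e : ∀ j, ENNReal.ofReal (ρ j ^ 2) * d j = 2 * (ENNReal.ofReal (ρ j ^ 2) *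
        ∫⁻ x in Set.Icc (ε * j - S) (ε * j + S + 1), g x) := fun j => by rw [hd]; ring
    simp_rw [e]
    rw [ENNReal.tsum_mul_left]
    calc _ ≤ 2 * (ENNReal.ofReal (C * (logLog (1 / ε) / ε ^ 2)) * lilNorm 3 F ^ 2) := by
          gcongr
          exact (h ε hε g hgm).trans (by gcongr)
      _ = ENNReal.ofReal (2 * (C * (logLog (1 / ε) / ε ^ 2) * (lilNorm 3 F).toReal ^ 2)) := by
          rw [ENNReal.ofReal_mul zero_le_two,
            ENNReal.ofReal_mul (p := C * (logLog (1 / ε) / ε ^ 2)) (by positivity),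
            ENNReal.ofReal_pow ENNReal.toReal_nonneg, ENNReal.ofReal_toReal hfin]
          norm_num
      _ ≤ _ := by
          refine ENNReal.ofReal_le_ofReal ?_
          have : 0 ≤ C * (logLog (1 / ε) / ε ^ 2) * (lilNorm 3 F).toReal ^ 2 := by positivity
          linarith
  have hρ2 : ∀ j, 1 ≤ ENNReal.ofReal (ρ j ^ 2) := fun j => by
    rw [← ENNReal.ofReal_one]
    exact ENNReal.ofReal_le_ofReal (one_le_pow₀ (hρ1 j))
  have hdfin : ∀ j, d j ≠ ∞ := fun j => by
    refine ne_top_of_le_ne_top (ne_top_of_le_ne_top ENNReal.ofReal_ne_top hdsum) ?_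
    calc d j ≤ ENNReal.ofReal (ρ j ^ 2) * d j := le_mul_of_one_le_left zero_le (hρ2 j)
      _ ≤ _ := ENNReal.le_tsum j
  have hbound : ∀ (G G' : ℝ → ℝ), (∀ x, ‖G x‖ₑ ^ 2 ≤
      2 * ∫⁻ y in Set.Icc x (x + 1), (‖G y‖ₑ ^ 2 + ‖G' y‖ₑ ^ 2)) →
      (∀ x, ‖G x‖ₑ ^ 2 + ‖G' x‖ₑ ^ 2 ≤ g x) →
      ∀ (j : ℤ) (s : ℝ), |s| ≤ S → |G (ε * j + s)| ≤ Real.sqrt (d j).toReal := by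
    intro G G' hG hGg j s hs
    have hs' := abs_le.mp hs
    have h1 : ‖G (ε * j + s)‖ₑ ^ 2 ≤ d j := by
      refine (hG _).trans ?_
      refine mul_le_mul_right ((lintegral_mono hGg).trans (lintegral_mono_set ?_)) 2
      exact Set.Icc_subset_Icc (by linarith) (by linarith)
    refine Real.abs_le_sqrt ?_
    have h2 := ENNReal.toReal_mono (hdfin j) h1
    rw [ENNReal.toReal_pow, toReal_enorm, Real.norm_eq_abs, sq_abs] at h2
    exact h2
  have hftc : ∀ {G G' : ℝ → ℝ}, (∀ x, HasDerivAt G (G' x) x) → Continuous G' →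
      ∀ x y, G y - G x = ∫ t in x..y, G' t := fun hGd hGc x y =>
    (intervalIntegral.integral_eq_sub_of_hasDerivAt (fun t _ => hGd t)
      (hGc.intervalIntegrable _ _)).symm
  refine ⟨fun j => Real.sqrt (d j).toReal, fun j => Real.sqrt_nonneg _, fun j s hs =>
    ⟨?_, ?_, ?_⟩, ?_⟩
  · refine hbound F F₁ (enorm_sq_le_lintegral_Icc hF.continuous hF1.locallyIntegrable
      (hftc hd1 hF1)) (fun x => ?_) j s hs
    simp only [hg, add_assoc]
    gcongr
    exact le_self_add
  · refine hbound F₁ F₂ (enorm_sq_le_lintegral_Icc hF1 hF2.locallyIntegrable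
      (hftc hd2 hF2)) (fun x => ?_) j s hs
    simp only [hg]
    refine le_trans ?_ le_self_add
    rw [add_assoc]
    exact le_add_self
  · refine hbound F₂ F₃ (enorm_sq_le_lintegral_Icc hF2 hF3 hint) (fun x => ?_) j s hs
    simp only [hg]
    rw [add_assoc]
    exact le_add_self
  · refine le_trans (le_of_eq (tsum_congr fun j => ?_)) hdsum
    rw [mul_pow, Real.sq_sqrt ENNReal.toReal_nonneg, ENNReal.ofReal_mul (sq_nonneg _),
      ENNReal.ofReal_toReal (hdfin j)]

/-! ### The Hilbert space of square summable sequences -/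

lemma hasSum_sq (x : EllTwo) : HasSum (fun j => x j ^ 2) (‖x‖ ^ 2) := by
  have h := lp.hasSum_norm (p := 2) (by norm_num) x
  simpa using h

lemma exists_ellTwo_of_summable {f : ℤ → ℝ} (h : Summable fun j => f j ^ 2) :
    ∃ x : EllTwo, ∀ j, x j = f j :=
  ⟨⟨f, memℓp_gen (by simpa using h)⟩, fun _ => rfl⟩

lemma hasSum_mul (x y : EllTwo) : HasSum (fun j => x j * y j) (inner ℝ x y) := by
  have h := lp.hasSum_inner (𝕜 := ℝ) x y
  simpa [mul_comm] using h

lemma norm_le_of_abs_le {x y : EllTwo} {C : ℝ} (hC : 0 ≤ C) (h : ∀ j, |x j| ≤ C * |y j|) :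
    ‖x‖ ≤ C * ‖y‖ := by
  refine le_of_sq_le_sq ?_ (by positivity)
  rw [mul_pow]
  refine hasSum_le (fun j => ?_) (hasSum_sq x) ((hasSum_sq y).mul_left (C ^ 2))
  rw [← sq_abs (x j), ← sq_abs (y j), ← mul_pow]
  exact pow_le_pow_left₀ (abs_nonneg _) (h j) 2

/-- Shifting a square summable sequence and multiplying it by a bounded one. -/
lemma exists_weightedShift {w : ℤ → ℝ} {C : ℝ} (hw : ∀ j, |w j| ≤ C) (n : ℤ) :
    ∃ T : EllTwo →L[ℝ] EllTwo, ∀ x j, T x j = w j * x (j + n) := by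
  have hC : 0 ≤ C := (abs_nonneg _).trans (hw 0)
  have hshift : ∀ x : EllTwo, HasSum (fun j => x (j + n) ^ 2) (‖x‖ ^ 2) := fun x =>
    (Equiv.addRight n).hasSum_iff.mpr (hasSum_sq x)
  have hle : ∀ (x : EllTwo) (j : ℤ), (w j * x (j + n)) ^ 2 ≤ C ^ 2 * x (j + n) ^ 2 := by
    intro x j
    rw [mul_pow]
    gcongr ?_ * _
    rw [← sq_abs]
    exact pow_le_pow_left₀ (abs_nonneg _) (hw j) 2
  have hmem : ∀ x : EllTwo, Memℓp (fun j => w j * x (j + n)) 2 := fun x => by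
    refine memℓp_gen ?_
    have hs := Summable.of_nonneg_of_le (fun j => sq_nonneg (w j * x (j + n))) (hle x)
      ((hshift x).summable.mul_left (C ^ 2))
    simpa [mul_pow] using hs
  let T : EllTwo →ₗ[ℝ] EllTwo :=
    { toFun := fun x => ⟨fun j => w j * x (j + n), hmem x⟩
      map_add' := fun x y => by
        ext j
        exact mul_add (w j) (x (j + n)) (y (j + n))
      map_smul' := fun a x => by
        ext j
        exact mul_left_comm (w j) a (x (j + n)) }
  refine ⟨T.mkContinuous C fun x => ?_, fun x j => rfl⟩
  refine le_of_sq_le_sq ?_ (by positivity)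
  rw [mul_pow]
  exact hasSum_le (hle x) (hasSum_sq (T x)) ((hshift x).mul_left (C ^ 2))

lemma ellTwoNorm_le_of_tsum_le {f : ℤ → ℝ} {c : ℝ} (hc : 0 ≤ c)
    (h : ∑' j, ENNReal.ofReal (f j ^ 2) ≤ ENNReal.ofReal (c ^ 2)) :
    ellTwoNorm f ≤ ENNReal.ofReal c := by
  have h2 : ellTwoNorm f ^ 2 ≤ ENNReal.ofReal c ^ 2 := by
    rw [ellTwoNorm, eLpNorm_two_sq, lintegral_count, ← ENNReal.ofReal_pow hc]
    refine le_trans (le_of_eq (tsum_congr fun j => ?_)) h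
    rw [← sq_abs, ENNReal.ofReal_pow (abs_nonneg _), Real.enorm_eq_ofReal_abs]
  exact (ENNReal.pow_le_pow_left_iff two_ne_zero).mp h2

lemma ellTwoNorm_coe_le (x : EllTwo) {c : ℝ} (h : ‖x‖ ≤ c) :
    ellTwoNorm (fun j => x j) ≤ ENNReal.ofReal c := by
  have hc : 0 ≤ c := (norm_nonneg x).trans h
  refine ellTwoNorm_le_of_tsum_le hc ?_
  rw [← ENNReal.ofReal_tsum_of_nonneg (fun j => sq_nonneg _) (hasSum_sq x).summable,
    (hasSum_sq x).tsum_eq]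
  exact ENNReal.ofReal_le_ofReal (by gcongr)

/-- A curve of square summable sequences whose coordinates have derivatives dominated by a fixed
square summable sequence is differentiable in norm: dominated convergence applies to the difference
quotients. -/
lemma hasDerivAt_ellTwo_of_dominated {U : ℝ → EllTwo} {U' : ℝ → ℤ → ℝ} {v g : EllTwo} {t₀ τ : ℝ}
    (ht₀ : t₀ ∈ Set.Ioo (-τ) τ)
    (hU : ∀ t ∈ Set.Ioo (-τ) τ, ∀ j, HasDerivAt (fun t => U t j) (U' t j) t)
    (hg : ∀ t ∈ Set.Ioo (-τ) τ, ∀ j, |U' t j| ≤ g j) (hv : ∀ j, v j = U' t₀ j) :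
    HasDerivAt U v t₀ := by
  rw [hasDerivAt_iff_tendsto_slope, tendsto_iff_norm_sub_tendsto_zero]
  have hsq : Filter.Tendsto (fun t => ‖slope U t₀ t - v‖ ^ 2) (nhdsWithin t₀ {t₀}ᶜ)
      (nhds 0) := by
    have hcoord : ∀ t j, (slope U t₀ t - v) j = slope (fun t => U t j) t₀ t - U' t₀ j := by
      intro t j
      rw [← hv j]
      rw [slope_def_module, slope_def_module]
      rfl
    have heq : ∀ t, ‖slope U t₀ t - v‖ ^ 2 =
        ∑' j, (slope (fun t => U t j) t₀ t - U' t₀ j) ^ 2 := by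
      intro t
      rw [← (hasSum_sq _).tsum_eq]
      exact tsum_congr fun j => by rw [hcoord]
    simp_rw [heq]
    have hzero : (0 : ℝ) = ∑' _ : ℤ, (0 : ℝ) := by simp
    rw [hzero]
    refine tendsto_tsum_of_dominated_convergence (bound := fun j => 4 * g j ^ 2)
      ((hasSum_sq g).summable.mul_left 4) (fun j => ?_) ?_
    · have h1 := (hU t₀ ht₀ j).tendsto_slope.sub_const (U' t₀ j)
      simpa using h1.pow 2
    · have hnhds : Set.Ioo (-τ) τ ∈ nhdsWithin t₀ {t₀}ᶜ :=
        mem_nhdsWithin_of_mem_nhds (Ioo_mem_nhds ht₀.1 ht₀.2)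
      filter_upwards [hnhds, self_mem_nhdsWithin] with t ht hne j
      have hgj : 0 ≤ g j := (abs_nonneg _).trans (hg t₀ ht₀ j)
      have h1 : |slope (fun t => U t j) t₀ t| ≤ g j := by
        have h2 := (convex_Ioo (-τ) τ).norm_image_sub_le_of_norm_hasDerivWithin_le
          (f := fun t => U t j) (fun s hs => (hU s hs j).hasDerivWithinAt)
          (fun s hs => hg s hs j) ht₀ ht
        have h3 : 0 < |t - t₀| := abs_pos.mpr (sub_ne_zero.mpr hne)
        rw [slope_def_field, abs_div, div_le_iff₀ h3]
        exact h2
      rw [Real.norm_eq_abs, abs_of_nonneg (sq_nonneg _)]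
      have h4 : |slope (fun t => U t j) t₀ t - U' t₀ j| ≤ 2 * g j :=
        (abs_sub _ _).trans (by linarith [hg t₀ ht₀ j])
      calc (slope (fun t => U t j) t₀ t - U' t₀ j) ^ 2
          = |slope (fun t => U t j) t₀ t - U' t₀ j| ^ 2 := (sq_abs _).symm
        _ ≤ (2 * g j) ^ 2 := pow_le_pow_left₀ (abs_nonneg _) h4 2
        _ = 4 * g j ^ 2 := by ring
  have h := hsq.sqrt
  simpa [Real.sqrt_sq (norm_nonneg _)] using h

/-! ### The lattice system -/

/-- The lattice system is a linear differential equation with bounded generator. -/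
theorem exists_unique_isSolution {k m : ℤ → ℝ} {κ M : ℝ} (hk : ∀ j, |k j| ≤ κ)
    (hm : ∀ j, |1 / m j| ≤ M) (r₀ p₀ : EllTwo) :
    ∃ r p : ℝ → EllTwo, IsSolution k m r₀ p₀ r p ∧
      ∀ r' p' : ℝ → EllTwo, IsSolution k m r₀ p₀ r' p' → r' = r ∧ p' = p := by
  obtain ⟨T₁, hT1⟩ := exists_weightedShift (w := fun _ => 1) (C := 1) (by simp) 1
  obtain ⟨T₂, hT2⟩ := exists_weightedShift (w := fun j => 1 / m j * k j) (C := M * κ)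
    (fun j => by
      rw [abs_mul]
      exact mul_le_mul (hm j) (hk j) (abs_nonneg _) ((abs_nonneg _).trans (hm j))) 0
  obtain ⟨T₃, hT3⟩ := exists_weightedShift (w := fun j => 1 / m j * k (j - 1)) (C := M * κ)
    (fun j => by
      rw [abs_mul]
      exact mul_le_mul (hm j) (hk _) (abs_nonneg _) ((abs_nonneg _).trans (hm j))) (-1)
  let L : EllTwo × EllTwo →L[ℝ] EllTwo × EllTwo :=
    ((T₁ - ContinuousLinearMap.id ℝ EllTwo).comp (ContinuousLinearMap.snd ℝ EllTwo EllTwo)).prod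
      ((T₂ - T₃).comp (ContinuousLinearMap.fst ℝ EllTwo EllTwo))
  have hL1 : ∀ (u : EllTwo × EllTwo) (j : ℤ), (L u).1 j = u.2 (j + 1) - u.2 j := by
    intro u j
    change (T₁ u.2 - u.2) j = _
    simp [hT1]
  have hL2 : ∀ (u : EllTwo × EllTwo) (j : ℤ),
      (L u).2 j = (1 / m j) * (k j * u.1 j - k (j - 1) * u.1 (j - 1)) := by
    intro u j
    change (T₂ u.1 - T₃ u.1) j = _
    simp only [lp.coeFn_sub, Pi.sub_apply, hT2, hT3, add_zero, ← sub_eq_add_neg]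
    ring
  have hode : ∀ r p : ℝ → EllTwo, IsSolution k m r₀ p₀ r p →
      ∀ t, HasDerivAt (fun t => (r t, p t)) (L (r t, p t)) t := by
    intro r p h t
    have h1 : deriv r t = (L (r t, p t)).1 := by
      ext j
      rw [h.deriv_r, hL1]
    have h2 : deriv p t = (L (r t, p t)).2 := by
      ext j
      rw [h.deriv_p, hL2]
    have h3 := (h.differentiable_r t).hasDerivAt.prodMk (h.differentiable_p t).hasDerivAt
    rwa [h1, h2] at h3
  let u : ℝ → EllTwo × EllTwo := fun t => NormedSpace.exp (t • L) (r₀, p₀)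
  have hu : ∀ t, HasDerivAt u (L (u t)) t := by
    intro t
    have h := (hasDerivAt_exp_smul_const' (𝕂 := ℝ) L t).clm_apply
      (hasDerivAt_const t ((r₀, p₀) : EllTwo × EllTwo))
    simpa using h
  have hu0 : u 0 = (r₀, p₀) := by simp [u]
  have hu1 : ∀ t, HasDerivAt (fun t => (u t).1) (L (u t)).1 t := fun t => (hu t).fst
  have hu2 : ∀ t, HasDerivAt (fun t => (u t).2) (L (u t)).2 t := fun t => (hu t).snd
  refine ⟨fun t => (u t).1, fun t => (u t).2, ⟨fun t => (hu1 t).differentiableAt,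
    fun t => (hu2 t).differentiableAt, fun t j => ?_, fun t j => ?_, fun j => ?_, fun j => ?_⟩,
    fun r' p' h => ?_⟩
  · rw [(hu1 t).deriv, hL1]
  · rw [(hu2 t).deriv, hL2]
  · rw [hu0]
  · rw [hu0]
  · have hinit : (r' 0, p' 0) = u 0 := by
      rw [hu0]
      refine Prod.ext ?_ ?_
      · ext j; exact h.init_r j
      · ext j; exact h.init_p j
    have heq : (fun t => (r' t, p' t)) = u :=
      ODE_solution_unique_univ (v := fun _ => L) (s := fun _ => Set.univ) (K := ‖L‖₊) (t₀ := 0)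
        (fun _ => L.lipschitz.lipschitzOnWith) (fun t => ⟨hode r' p' h t, trivial⟩)
        (fun t => ⟨hu t, trivial⟩) hinit
    exact ⟨funext fun t => congrArg Prod.fst (congrFun heq t),
      funext fun t => congrArg Prod.snd (congrFun heq t)⟩

/-! ### The energy estimate -/

/-- Integration of `E' ≤ 2 A √E`. -/
lemma sqrt_le_of_abs_deriv_le {E E' : ℝ → ℝ} {A τ : ℝ} (hE : ∀ t, 0 ≤ E t)
    (hd : ∀ t ∈ Set.Ioo (-τ) τ, HasDerivAt E (E' t) t)
    (hb : ∀ t ∈ Set.Ioo (-τ) τ, |E' t| ≤ 2 * A * Real.sqrt (E t)) (hA : 0 ≤ A)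
    {t : ℝ} (ht : t ∈ Set.Ioo (-τ) τ) :
    Real.sqrt (E t) ≤ Real.sqrt (E 0) + A * |t| := by
  have h0 : (0 : ℝ) ∈ Set.Ioo (-τ) τ := by
    have := ht.1.trans ht.2
    constructor <;> linarith
  refine le_of_forall_pos_le_add fun δ hδ => ?_
  have hpos : ∀ s, 0 < E s + δ ^ 2 := fun s => by have := hE s; positivity
  have hderiv : ∀ s ∈ Set.Ioo (-τ) τ, HasDerivWithinAt (fun s => Real.sqrt (E s + δ ^ 2))
      (E' s / (2 * Real.sqrt (E s + δ ^ 2))) (Set.Ioo (-τ) τ) s := fun s hs =>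
    (((hd s hs).add_const (δ ^ 2)).sqrt (hpos s).ne').hasDerivWithinAt
  have hbound : ∀ s ∈ Set.Ioo (-τ) τ, ‖E' s / (2 * Real.sqrt (E s + δ ^ 2))‖ ≤ A := by
    intro s hs
    have h1 : 0 < Real.sqrt (E s + δ ^ 2) := Real.sqrt_pos.mpr (hpos s)
    have h2 : Real.sqrt (E s) ≤ Real.sqrt (E s + δ ^ 2) :=
      Real.sqrt_le_sqrt (by linarith [sq_nonneg δ])
    rw [Real.norm_eq_abs, abs_div, abs_of_pos (by positivity : 0 < 2 * Real.sqrt (E s + δ ^ 2)),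
      div_le_iff₀ (by positivity)]
    calc |E' s| ≤ 2 * A * Real.sqrt (E s) := hb s hs
      _ ≤ 2 * A * Real.sqrt (E s + δ ^ 2) := by gcongr
      _ = A * (2 * Real.sqrt (E s + δ ^ 2)) := by ring
  have hmv := (convex_Ioo (-τ) τ).norm_image_sub_le_of_norm_hasDerivWithin_le hderiv hbound h0 ht
  rw [Real.norm_eq_abs, Real.norm_eq_abs, sub_zero] at hmv
  have h1 : Real.sqrt (E t) ≤ Real.sqrt (E t + δ ^ 2) :=
    Real.sqrt_le_sqrt (by linarith [sq_nonneg δ])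
  have h2 : Real.sqrt (E 0 + δ ^ 2) ≤ Real.sqrt (E 0) + δ := by
    refine (Real.sqrt_le_left (by positivity)).mpr ?_
    nlinarith [Real.sq_sqrt (hE 0), Real.sqrt_nonneg (E 0)]
  linarith [le_abs_self (Real.sqrt (E t + δ ^ 2) - Real.sqrt (E 0 + δ ^ 2))]

/-- Stability of the lattice system: the energy `∑ (k R² + m V²)` is conserved up to the
residuals `f` and `g`, and is equivalent to the square of the norm. -/
theorem exists_norm_le_of_residual {k m : ℤ → ℝ} {κ₀ κ₁ μ₀ μ₁ : ℝ} (hκ₀ : 0 < κ₀)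
    (hk : ∀ j, k j ∈ Set.Icc κ₀ κ₁) (hμ₀ : 0 < μ₀) (hm : ∀ j, m j ∈ Set.Icc μ₀ μ₁) :
    ∃ C : ℝ, 0 < C ∧ ∀ (R V R' V' f g : ℝ → EllTwo) (τ G : ℝ), 0 ≤ G →
      (∀ t ∈ Set.Ioo (-τ) τ, HasDerivAt R (R' t) t) →
      (∀ t ∈ Set.Ioo (-τ) τ, HasDerivAt V (V' t) t) →
      (∀ t ∈ Set.Ioo (-τ) τ, ∀ j, R' t j = V t (j + 1) - V t j + f t j) →
      (∀ t ∈ Set.Ioo (-τ) τ, ∀ j, m j * V' t j = k j * R t j - k (j - 1) * R t (j - 1) + g t j) →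
      (∀ t ∈ Set.Ioo (-τ) τ, ‖f t‖ ≤ G) → (∀ t ∈ Set.Ioo (-τ) τ, ‖g t‖ ≤ G) →
      ∀ t ∈ Set.Ioo (-τ) τ, ‖R t‖ ≤ C * (‖R 0‖ + ‖V 0‖ + τ * G) ∧
        ‖V t‖ ≤ C * (‖R 0‖ + ‖V 0‖ + τ * G) := by
  have hκ₁ : 0 < κ₁ := hκ₀.trans_le ((hk 0).1.trans (hk 0).2)
  have hμ₁ : 0 < μ₁ := hμ₀.trans_le ((hm 0).1.trans (hm 0).2)
  have hk0 : ∀ j, 0 ≤ k j := fun j => hκ₀.le.trans (hk j).1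
  have hm0 : ∀ j, 0 ≤ m j := fun j => hμ₀.le.trans (hm j).1
  obtain ⟨P, hP⟩ := exists_weightedShift (w := fun j => Real.sqrt (k j)) (C := Real.sqrt κ₁)
    (fun j => by rw [abs_of_nonneg (Real.sqrt_nonneg _)]; exact Real.sqrt_le_sqrt (hk j).2) 0
  obtain ⟨Q, hQ⟩ := exists_weightedShift (w := fun j => Real.sqrt (m j)) (C := Real.sqrt μ₁)
    (fun j => by rw [abs_of_nonneg (Real.sqrt_nonneg _)]; exact Real.sqrt_le_sqrt (hm j).2) 0
  simp only [add_zero] at hP hQ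
  have hPle : ∀ x, ‖P x‖ ≤ Real.sqrt κ₁ * ‖x‖ := fun x =>
    norm_le_of_abs_le (Real.sqrt_nonneg _) fun j => by
      rw [hP, abs_mul, abs_of_nonneg (Real.sqrt_nonneg _)]
      gcongr
      exact (hk j).2
  have hQle : ∀ x, ‖Q x‖ ≤ Real.sqrt μ₁ * ‖x‖ := fun x =>
    norm_le_of_abs_le (Real.sqrt_nonneg _) fun j => by
      rw [hQ, abs_mul, abs_of_nonneg (Real.sqrt_nonneg _)]
      gcongr
      exact (hm j).2
  have hPge : ∀ x, ‖x‖ ≤ (1 / Real.sqrt κ₀) * ‖P x‖ := fun x =>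
    norm_le_of_abs_le (by positivity) fun j => by
      rw [hP, abs_mul, abs_of_nonneg (Real.sqrt_nonneg _), one_div, ← div_eq_inv_mul,
        le_div_iff₀ (Real.sqrt_pos.mpr hκ₀), mul_comm]
      gcongr
      exact (hk j).1
  have hQge : ∀ x, ‖x‖ ≤ (1 / Real.sqrt μ₀) * ‖Q x‖ := fun x =>
    norm_le_of_abs_le (by positivity) fun j => by
      rw [hQ, abs_mul, abs_of_nonneg (Real.sqrt_nonneg _), one_div, ← div_eq_inv_mul,
        le_div_iff₀ (Real.sqrt_pos.mpr hμ₀), mul_comm]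
      gcongr
      exact (hm j).1
  set a : ℝ := Real.sqrt κ₁ + 1 / Real.sqrt μ₀ with ha
  set b : ℝ := 1 / Real.sqrt κ₀ + 1 / Real.sqrt μ₀ with hb
  set d : ℝ := Real.sqrt κ₁ + Real.sqrt μ₁ + a with hdd
  have hsκ₀ := Real.sqrt_pos.mpr hκ₀
  have hsκ₁ := Real.sqrt_pos.mpr hκ₁
  have hsμ₀ := Real.sqrt_pos.mpr hμ₀
  have hsμ₁ := Real.sqrt_pos.mpr hμ₁
  refine ⟨b * d, by positivity, ?_⟩
  intro R V R' V' f g τ G hG hR hV hR' hV' hf hg t ht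
  set E : ℝ → ℝ := fun t => ‖P (R t)‖ ^ 2 + ‖Q (V t)‖ ^ 2 with hE
  have hE0 : ∀ t, 0 ≤ E t := fun t => by positivity
  have hPE : ∀ t, ‖P (R t)‖ ≤ Real.sqrt (E t) := fun t =>
    Real.le_sqrt_of_sq_le (by simp only [hE]; linarith [sq_nonneg ‖Q (V t)‖])
  have hQE : ∀ t, ‖Q (V t)‖ ≤ Real.sqrt (E t) := fun t =>
    Real.le_sqrt_of_sq_le (by simp only [hE]; linarith [sq_nonneg ‖P (R t)‖])
  have hder : ∀ t ∈ Set.Ioo (-τ) τ, HasDerivAt E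
      (2 * inner ℝ (P (R t)) (P (R' t)) + 2 * inner ℝ (Q (V t)) (Q (V' t))) t := fun t ht =>
    (P.hasFDerivAt.comp_hasDerivAt t (hR t ht)).norm_sq.add
      (Q.hasFDerivAt.comp_hasDerivAt t (hV t ht)).norm_sq
  -- The fluxes `k (j - 1) R (j - 1) V j` telescope, so that only the residuals contribute.
  have hinner : ∀ t ∈ Set.Ioo (-τ) τ, inner ℝ (P (R t)) (P (R' t)) +
      inner ℝ (Q (V t)) (Q (V' t)) = inner ℝ (P (R t)) (P (f t)) + inner ℝ (V t) (g t) := by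
    intro t ht
    obtain ⟨T, hT⟩ := exists_weightedShift (w := fun j => k (j - 1)) (C := κ₁)
      (fun j => by rw [abs_of_nonneg (hk0 _)]; exact (hk _).2) (-1)
    have hflux : HasSum (fun j => k (j - 1) * R t (j - 1) * V t j) (inner ℝ (T (R t)) (V t)) := by
      have h := hasSum_mul (T (R t)) (V t)
      simp only [hT, ← sub_eq_add_neg] at h
      exact h
    have hflux' := (Equiv.addRight (1 : ℤ)).hasSum_iff.mpr hflux
    have hlhs := (hasSum_mul (P (R t)) (P (R' t))).add (hasSum_mul (Q (V t)) (Q (V' t)))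
    have hrhs := ((hasSum_mul (P (R t)) (P (f t))).add (hasSum_mul (V t) (g t))).add
      (hflux'.sub hflux)
    rw [sub_self, add_zero] at hrhs
    refine hlhs.unique ?_
    convert hrhs using 1
    funext j
    simp only [hP, hQ, Function.comp_apply, Equiv.coe_addRight, add_sub_cancel_right]
    have e1 := Real.mul_self_sqrt (hk0 j)
    have e2 := Real.mul_self_sqrt (hm0 j)
    have e3 := hR' t ht j
    have e4 := hV' t ht j
    calc Real.sqrt (k j) * R t j * (Real.sqrt (k j) * R' t j) +
        Real.sqrt (m j) * V t j * (Real.sqrt (m j) * V' t j)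
        = (Real.sqrt (k j) * Real.sqrt (k j)) * R t j * R' t j +
          V t j * ((Real.sqrt (m j) * Real.sqrt (m j)) * V' t j) := by ring
      _ = (Real.sqrt (k j) * Real.sqrt (k j)) * R t j * f t j + V t j * g t j +
          (k j * R t j * V t (j + 1) - k (j - 1) * R t (j - 1) * V t j) := by
          rw [e1, e2, e3, e4]; ring
      _ = _ := by ring
  have hbound : ∀ t ∈ Set.Ioo (-τ) τ,
      |2 * inner ℝ (P (R t)) (P (R' t)) + 2 * inner ℝ (Q (V t)) (Q (V' t))| ≤
        2 * (a * G) * Real.sqrt (E t) := by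
    intro t ht
    rw [← mul_add, hinner t ht, abs_mul, abs_two, mul_assoc]
    refine mul_le_mul_of_nonneg_left ?_ zero_le_two
    have h1 : |inner ℝ (P (R t)) (P (f t))| ≤ Real.sqrt (E t) * (Real.sqrt κ₁ * G) :=
      (abs_real_inner_le_norm _ _).trans (mul_le_mul (hPE t)
        ((hPle _).trans (by gcongr; exact hf t ht)) (norm_nonneg _) (Real.sqrt_nonneg _))
    have h2 : |inner ℝ (V t) (g t)| ≤ (1 / Real.sqrt μ₀ * Real.sqrt (E t)) * G :=
      (abs_real_inner_le_norm _ _).trans (mul_le_mul ((hQge _).trans (by gcongr; exact hQE t))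
        (hg t ht) (norm_nonneg _) (by positivity))
    calc _ ≤ _ := abs_add_le _ _
      _ ≤ Real.sqrt (E t) * (Real.sqrt κ₁ * G) + (1 / Real.sqrt μ₀ * Real.sqrt (E t)) * G :=
        add_le_add h1 h2
      _ = a * G * Real.sqrt (E t) := by rw [ha]; ring
  have hsqrt := sqrt_le_of_abs_deriv_le hE0 hder hbound (by positivity) ht
  have hinit : Real.sqrt (E 0) ≤ Real.sqrt κ₁ * ‖R 0‖ + Real.sqrt μ₁ * ‖V 0‖ := by
    refine (Real.sqrt_le_left (by positivity)).mpr ?_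
    have h1 := pow_le_pow_left₀ (norm_nonneg _) (hPle (R 0)) 2
    have h2 := pow_le_pow_left₀ (norm_nonneg _) (hQle (V 0)) 2
    have h3 : 0 ≤ (Real.sqrt κ₁ * ‖R 0‖) * (Real.sqrt μ₁ * ‖V 0‖) := by positivity
    simp only [hE]
    linarith [add_sq (Real.sqrt κ₁ * ‖R 0‖) (Real.sqrt μ₁ * ‖V 0‖)]
  have htau : |t| ≤ τ := (abs_lt.mpr ht).le
  have hτ : 0 ≤ τ := (abs_nonneg t).trans htau
  have hfinal : Real.sqrt (E t) ≤ d * (‖R 0‖ + ‖V 0‖ + τ * G) := by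
    have h1 : a * G * |t| ≤ a * (τ * G) := by
      calc a * G * |t| ≤ a * G * τ := by gcongr
        _ = a * (τ * G) := by ring
    have hR0 := norm_nonneg (R 0)
    have hV0 := norm_nonneg (V 0)
    have hτG : 0 ≤ τ * G := by positivity
    have ha0 : 0 < a := by positivity
    have h2 : Real.sqrt κ₁ * ‖R 0‖ ≤ d * ‖R 0‖ := by gcongr; rw [hdd]; linarith
    have h3 : Real.sqrt μ₁ * ‖V 0‖ ≤ d * ‖V 0‖ := by gcongr; rw [hdd]; linarith
    have h4 : a * (τ * G) ≤ d * (τ * G) := by gcongr; rw [hdd]; linarith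
    rw [mul_add, mul_add]
    linarith
  have hge : ∀ y : ℝ, y ≤ Real.sqrt (E t) → 0 ≤ y → ∀ c : ℝ, 0 ≤ c → c ≤ b →
      c * y ≤ b * d * (‖R 0‖ + ‖V 0‖ + τ * G) := fun y hy hy0 c hc hcb => by
    rw [mul_assoc]
    exact mul_le_mul hcb (hy.trans hfinal) hy0 (hc.trans hcb)
  have hi1 : 0 < 1 / Real.sqrt κ₀ := by positivity
  have hi2 : 0 < 1 / Real.sqrt μ₀ := by positivity
  exact ⟨(hPge _).trans (hge _ (hPE t) (norm_nonneg _) _ hi1.le (by rw [hb]; linarith)),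
    (hQge _).trans (hge _ (hQE t) (norm_nonneg _) _ hi2.le (by rw [hb]; linarith))⟩

/-! ### The corrected travelling wave ansatz -/

lemma exists_ellTwo_of_abs_le {f : ℤ → ℝ} {g : EllTwo} {C : ℝ} (hC : 0 ≤ C)
    (h : ∀ j, |f j| ≤ C * g j) : ∃ x : EllTwo, (∀ j, x j = f j) ∧ ‖x‖ ≤ C * ‖g‖ := by
  have hs : Summable fun j => f j ^ 2 := by
    refine Summable.of_nonneg_of_le (fun j => sq_nonneg _) (fun j => ?_)
      ((hasSum_sq g).summable.mul_left (C ^ 2))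
    rw [← sq_abs, ← mul_pow]
    exact pow_le_pow_left₀ (abs_nonneg _) (h j) 2
  obtain ⟨x, hx⟩ := exists_ellTwo_of_summable hs
  refine ⟨x, hx, norm_le_of_abs_le hC fun j => ?_⟩
  rw [hx]
  exact (h j).trans (mul_le_mul_of_nonneg_left (le_abs_self _) hC)

/-- The superposition `α A(ε(x - ct)) + β B(ε(x + ct))` of two travelling waves. -/
def wave (α β : ℝ) (A B : ℝ → ℝ) (ε c t x : ℝ) : ℝ :=
  α * A (ε * (x - c * t)) + β * B (ε * (x + c * t))

lemma wave_smul (s α β : ℝ) (A B : ℝ → ℝ) (ε c t x : ℝ) :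
    wave (s * α) (s * β) A B ε c t x = s * wave α β A B ε c t x := by
  unfold wave; ring

lemma hasDerivAt_wave {A A₁ B B₁ : ℝ → ℝ} (hA : ∀ x, HasDerivAt A (A₁ x) x)
    (hB : ∀ x, HasDerivAt B (B₁ x) x) (α β ε c t x : ℝ) :
    HasDerivAt (fun t => wave α β A B ε c t x) (ε * c * wave (-α) β A₁ B₁ ε c t x) t := by
  have e1 : HasDerivAt (fun t => ε * (x - c * t)) (ε * (-(c * 1))) t :=
    (((hasDerivAt_id t).const_mul c).const_sub x).const_mul ε
  have e2 : HasDerivAt (fun t => ε * (x + c * t)) (ε * (c * 1)) t :=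
    (((hasDerivAt_id t).const_mul c).const_add x).const_mul ε
  have h1 := ((hA _).comp t e1).const_mul α
  have h2 := ((hB _).comp t e2).const_mul β
  have h := h1.add h2
  have hval : α * (A₁ (ε * (x - c * t)) * (ε * (-(c * 1)))) +
      β * (B₁ (ε * (x + c * t)) * (ε * (c * 1))) = ε * c * wave (-α) β A₁ B₁ ε c t x := by
    unfold wave; ring
  rw [hval] at h
  exact h

lemma abs_wave_le {A B : ℝ → ℝ} {ε c t x S D : ℝ} (hs : |ε * (c * t)| ≤ S)
    (hA : ∀ s, |s| ≤ S → |A (ε * x + s)| ≤ D) (hB : ∀ s, |s| ≤ S → |B (ε * x + s)| ≤ D)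
    (α β : ℝ) : |wave α β A B ε c t x| ≤ (|α| + |β|) * D := by
  have h1 := hA (-(ε * (c * t))) (by rwa [abs_neg])
  have h2 := hB (ε * (c * t)) hs
  have e1 : ε * x + -(ε * (c * t)) = ε * (x - c * t) := by ring
  have e2 : ε * x + ε * (c * t) = ε * (x + c * t) := by ring
  rw [e1] at h1
  rw [e2] at h2
  unfold wave
  calc _ ≤ _ := abs_add_le _ _
    _ = |α| * |A (ε * (x - c * t))| + |β| * |B (ε * (x + c * t))| := by rw [abs_mul, abs_mul]
    _ ≤ |α| * D + |β| * D := by gcongr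
    _ = _ := by ring

lemma abs_sub_le_of_deriv_le {F F₁ : ℝ → ℝ} (hF : ∀ x, HasDerivAt F (F₁ x) x) {x h D : ℝ}
    (hD : ∀ s, |s| ≤ |h| → |F₁ (x + s)| ≤ D) : |F (x + h) - F x| ≤ |h| * D := by
  have hmv := (convex_uIcc x (x + h)).norm_image_sub_le_of_norm_hasDerivWithin_le
    (fun y _ => (hF y).hasDerivWithinAt) (C := D) (fun y hy => ?_) Set.left_mem_uIcc
    Set.right_mem_uIcc
  · rw [Real.norm_eq_abs, Real.norm_eq_abs, add_sub_cancel_left, mul_comm] at hmv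
    exact hmv
  · have h1 := Set.abs_sub_left_of_mem_uIcc hy
    rw [add_sub_cancel_left] at h1
    have h2 := hD (y - x) h1
    rwa [add_sub_cancel] at h2

lemma abs_taylor_le {F F₁ F₂ : ℝ → ℝ} (hF : ∀ x, HasDerivAt F (F₁ x) x)
    (hF₁ : ∀ x, HasDerivAt F₁ (F₂ x) x) {x h D : ℝ}
    (hD : ∀ s, |s| ≤ |h| → |F₂ (x + s)| ≤ D) : |F (x + h) - F x - h * F₁ x| ≤ h ^ 2 * D := by
  have hG : ∀ y, HasDerivAt (fun y => F y - y * F₁ x) (F₁ y - 1 * F₁ x) y := fun y =>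
    (hF y).sub ((hasDerivAt_id y).mul_const _)
  have h0 : 0 ≤ D := (abs_nonneg _).trans (hD 0 (by simp))
  have hb : ∀ s, |s| ≤ |h| → |F₁ (x + s) - 1 * F₁ x| ≤ |h| * D := fun s hs => by
    rw [one_mul]
    refine (abs_sub_le_of_deriv_le hF₁ fun u hu => hD u (hu.trans hs)).trans ?_
    gcongr
  have h1 := abs_sub_le_of_deriv_le hG hb
  have e : F (x + h) - (x + h) * F₁ x - (F x - x * F₁ x) = F (x + h) - F x - h * F₁ x := by ring
  rw [e, ← mul_assoc, abs_mul_abs_self] at h1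
  rwa [sq]

lemma abs_wave_sub_le {A A₁ B B₁ : ℝ → ℝ} (hA : ∀ x, HasDerivAt A (A₁ x) x)
    (hB : ∀ x, HasDerivAt B (B₁ x) x) {ε c t x S D h : ℝ} (hh : |h| = 1)
    (hs : |ε * (c * t)| + |ε| ≤ S) (hA₁ : ∀ s, |s| ≤ S → |A₁ (ε * x + s)| ≤ D)
    (hB₁ : ∀ s, |s| ≤ S → |B₁ (ε * x + s)| ≤ D) (α β : ℝ) :
    |wave α β A B ε c t (x + h) - wave α β A B ε c t x| ≤ |ε| * ((|α| + |β|) * D) := by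
  have hεh : |ε * h| = |ε| := by rw [abs_mul, hh, mul_one]
  have h1 : |A (ε * (x - c * t) + ε * h) - A (ε * (x - c * t))| ≤ |ε * h| * D :=
    abs_sub_le_of_deriv_le hA fun s hs' => by
      have e : ε * (x - c * t) + s = ε * x + (s + -(ε * (c * t))) := by ring
      rw [e]
      refine hA₁ _ ((abs_add_le _ _).trans ?_)
      rw [abs_neg]
      linarith
  have h2 : |B (ε * (x + c * t) + ε * h) - B (ε * (x + c * t))| ≤ |ε * h| * D :=
    abs_sub_le_of_deriv_le hB fun s hs' => by
      have e : ε * (x + c * t) + s = ε * x + (s + ε * (c * t)) := by ring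
      rw [e]
      exact hB₁ _ ((abs_add_le _ _).trans (by linarith))
  rw [hεh] at h1 h2
  have e : wave α β A B ε c t (x + h) - wave α β A B ε c t x =
      α * (A (ε * (x - c * t) + ε * h) - A (ε * (x - c * t))) +
      β * (B (ε * (x + c * t) + ε * h) - B (ε * (x + c * t))) := by
    unfold wave
    rw [show ε * (x + h - c * t) = ε * (x - c * t) + ε * h by ring,
      show ε * (x + h + c * t) = ε * (x + c * t) + ε * h by ring]
    ring
  rw [e]
  calc _ ≤ _ := abs_add_le _ _
    _ ≤ |α| * (|ε| * D) + |β| * (|ε| * D) := by rw [abs_mul, abs_mul]; gcongr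
    _ = _ := by ring

lemma abs_wave_taylor_le {A A₁ A₂ B B₁ B₂ : ℝ → ℝ} (hA : ∀ x, HasDerivAt A (A₁ x) x)
    (hA₁ : ∀ x, HasDerivAt A₁ (A₂ x) x) (hB : ∀ x, HasDerivAt B (B₁ x) x)
    (hB₁ : ∀ x, HasDerivAt B₁ (B₂ x) x) {ε c t x S D h : ℝ} (hh : |h| = 1)
    (hs : |ε * (c * t)| + |ε| ≤ S) (hA₂ : ∀ s, |s| ≤ S → |A₂ (ε * x + s)| ≤ D)
    (hB₂ : ∀ s, |s| ≤ S → |B₂ (ε * x + s)| ≤ D) (α β : ℝ) :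
    |wave α β A B ε c t (x + h) - wave α β A B ε c t x - ε * h * wave α β A₁ B₁ ε c t x| ≤
      ε ^ 2 * ((|α| + |β|) * D) := by
  have hεh : |ε * h| = |ε| := by rw [abs_mul, hh, mul_one]
  have hεh2 : (ε * h) ^ 2 = ε ^ 2 := by rw [← sq_abs, hεh, sq_abs]
  have h1 : |A (ε * (x - c * t) + ε * h) - A (ε * (x - c * t)) - ε * h * A₁ (ε * (x - c * t))| ≤
      (ε * h) ^ 2 * D :=
    abs_taylor_le hA hA₁ fun s hs' => by
      have e : ε * (x - c * t) + s = ε * x + (s + -(ε * (c * t))) := by ring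
      rw [e]
      refine hA₂ _ ((abs_add_le _ _).trans ?_)
      rw [abs_neg]
      linarith
  have h2 : |B (ε * (x + c * t) + ε * h) - B (ε * (x + c * t)) - ε * h * B₁ (ε * (x + c * t))| ≤
      (ε * h) ^ 2 * D :=
    abs_taylor_le hB hB₁ fun s hs' => by
      have e : ε * (x + c * t) + s = ε * x + (s + ε * (c * t)) := by ring
      rw [e]
      exact hB₂ _ ((abs_add_le _ _).trans (by linarith))
  rw [hεh2] at h1 h2
  have e : wave α β A B ε c t (x + h) - wave α β A B ε c t x - ε * h * wave α β A₁ B₁ ε c t x =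
      α * (A (ε * (x - c * t) + ε * h) - A (ε * (x - c * t)) - ε * h * A₁ (ε * (x - c * t))) +
      β * (B (ε * (x + c * t) + ε * h) - B (ε * (x + c * t)) -
        ε * h * B₁ (ε * (x + c * t))) := by
    unfold wave
    rw [show ε * (x + h - c * t) = ε * (x - c * t) + ε * h by ring,
      show ε * (x + h + c * t) = ε * (x + c * t) + ε * h by ring]
    ring
  rw [e]
  calc _ ≤ _ := abs_add_le _ _
    _ ≤ |α| * (ε ^ 2 * D) + |β| * (ε ^ 2 * D) := by rw [abs_mul, abs_mul]; gcongr
    _ = _ := by ring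

lemma abs_mul_add_corrector_le {s s' X Y e ε ρ N D : ℝ} (hs : 0 ≤ s) (hss : s ≤ s') (hε : 0 ≤ ε)
    (hε1 : ε ≤ 1) (hρ : 1 ≤ ρ) (he : |e| ≤ ρ) (hX : |X| ≤ N * D) (hY : |Y| ≤ N * D) :
    |s * (X + ε * e * Y)| ≤ (s' * (2 * N)) * (ρ * D) := by
  have hND : 0 ≤ N * D := (abs_nonneg _).trans hX
  have h1 : |ε * e * Y| ≤ ρ * (N * D) := by
    rw [abs_mul, abs_mul, abs_of_nonneg hε]
    refine mul_le_mul ?_ hY (abs_nonneg _) (by linarith)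
    calc ε * |e| ≤ 1 * ρ := mul_le_mul hε1 he (abs_nonneg _) zero_le_one
      _ = ρ := one_mul _
  have h2 : |X + ε * e * Y| ≤ 2 * (ρ * (N * D)) := by
    refine (abs_add_le _ _).trans ?_
    have : N * D ≤ ρ * (N * D) := le_mul_of_one_le_left hND hρ
    linarith
  rw [abs_mul, abs_of_nonneg hs]
  calc s * |X + ε * e * Y| ≤ s' * (2 * (ρ * (N * D))) :=
        mul_le_mul hss h2 (abs_nonneg _) (hs.trans hss)
    _ = _ := by ring

/-- The sum of a Taylor remainder, a corrector times a first difference, and a corrector times a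
second derivative, as it occurs in the residuals. -/
lemma abs_residual_le {X Y Z u v s s' ε ρ N D : ℝ} (hρ : 1 ≤ ρ) (hε : 0 ≤ ε)
    (hs : 0 ≤ s) (hss : s ≤ s') (hu : |u| ≤ ρ) (hv : |v| ≤ ρ) (hX : |X| ≤ ε ^ 2 * (N * D))
    (hY : |Y| ≤ ε * (N * D)) (hZ : |Z| ≤ N * D) :
    |X + ε * u * Y - ε ^ 2 * v * s * Z| ≤ (ε ^ 2 * (N * (2 + s'))) * (ρ * D) := by
  have hND : 0 ≤ N * D := (abs_nonneg _).trans hZ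
  have h1 : |ε * u * Y| ≤ ε ^ 2 * (ρ * (N * D)) := by
    rw [abs_mul, abs_mul, abs_of_nonneg hε]
    calc ε * |u| * |Y| ≤ ε * ρ * (ε * (N * D)) := by gcongr
      _ = _ := by ring
  have h2 : |ε ^ 2 * v * s * Z| ≤ ε ^ 2 * (s' * (ρ * (N * D))) := by
    rw [abs_mul, abs_mul, abs_mul, abs_of_nonneg (sq_nonneg ε), abs_of_nonneg hs]
    have hs' : 0 ≤ s' := hs.trans hss
    calc ε ^ 2 * |v| * s * |Z| ≤ ε ^ 2 * ρ * s' * (N * D) := by gcongr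
      _ = _ := by ring
  have h3 : ε ^ 2 * (N * D) ≤ ε ^ 2 * (ρ * (N * D)) :=
    mul_le_mul_of_nonneg_left (le_mul_of_one_le_left hND hρ) (sq_nonneg ε)
  calc |X + ε * u * Y - ε ^ 2 * v * s * Z| ≤ |X + ε * u * Y| + |ε ^ 2 * v * s * Z| := abs_sub _ _
    _ ≤ |X| + |ε * u * Y| + |ε ^ 2 * v * s * Z| := by gcongr; exact abs_add_le _ _
    _ ≤ ε ^ 2 * (ρ * (N * D)) + ε ^ 2 * (ρ * (N * D)) + ε ^ 2 * (s' * (ρ * (N * D))) := by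
        linarith
    _ = _ := by ring

/-- The travelling waves solve the lattice system up to `O(ε ‖ρ D‖)` on the time scale `1 / ε`.
The waves are first corrected by `ε b Q'` and `ε a P'`, where the increments of the correctors `a`
and `b` are the fluctuations of the coefficients: these cancel the residuals of order `ε`, and
what remains is of order `ε²`, with one factor `a` or `b`. -/
theorem exists_norm_sub_wave_le {k m a b ρ : ℤ → ℝ} {κ₀ κ₁ μ₀ μ₁ c σ T : ℝ} (hκ₀ : 0 < κ₀)
    (hk : ∀ j, k j ∈ Set.Icc κ₀ κ₁) (hμ₀ : 0 < μ₀) (hm : ∀ j, m j ∈ Set.Icc μ₀ μ₁) (hc : 0 < c)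
    (hσ : 0 < σ) (hT : 0 < T) (ha : ∀ j, a (j + 1) - a j = c * σ / k j - 1)
    (hb : ∀ j, b j - b (j - 1) = m j * (c / σ) - 1)
    (hρ : ∀ j, 1 ≤ ρ j ∧ |a j| ≤ ρ j ∧ |a (j + 1)| ≤ ρ j ∧ |b j| ≤ ρ j ∧ |b (j - 1)| ≤ ρ j) :
    ∃ C : ℝ, 0 < C ∧ ∀ A A₁ A₂ B B₁ B₂ : ℝ → ℝ, (∀ x, HasDerivAt A (A₁ x) x) →
      (∀ x, HasDerivAt A₁ (A₂ x) x) → (∀ x, HasDerivAt B (B₁ x) x) →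
      (∀ x, HasDerivAt B₁ (B₂ x) x) → ∀ ε ∈ Set.Ioo (0 : ℝ) (1 / 2), ∀ (D : ℤ → ℝ) (g : EllTwo),
      (∀ j, g j = ρ j * D j) →
      (∀ (j : ℤ) (s : ℝ), |s| ≤ c * T + 1 →
        |A (ε * j + s)| ≤ D j ∧ |A₁ (ε * j + s)| ≤ D j ∧ |A₂ (ε * j + s)| ≤ D j) →
      (∀ (j : ℤ) (s : ℝ), |s| ≤ c * T + 1 →
        |B (ε * j + s)| ≤ D j ∧ |B₁ (ε * j + s)| ≤ D j ∧ |B₂ (ε * j + s)| ≤ D j) →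
      ∀ (r₀ p₀ : ℤ → ℝ) (r p : ℝ → EllTwo), IsSolution k m r₀ p₀ r p →
      (∀ j, r₀ j = 1 / k j * (A (ε * j) + B (ε * j))) →
      (∀ j, p₀ j = 1 / σ * (-A (ε * j) + B (ε * j))) →
      ∀ t ∈ Set.Ioo (-(T / ε)) (T / ε), ∃ x y : EllTwo,
        (∀ j : ℤ, x j = r t j - 1 / k j * (A (ε * (j - c * t)) + B (ε * (j + c * t)))) ∧
        (∀ j : ℤ, y j = p t j - 1 / σ * (-A (ε * (j - c * t)) + B (ε * (j + c * t)))) ∧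
        ‖x‖ ≤ C * ε * ‖g‖ ∧ ‖y‖ ≤ C * ε * ‖g‖ := by
  obtain ⟨C₁, hC₁, henergy⟩ := exists_norm_le_of_residual hκ₀ hk hμ₀ hm
  have hμ₁ : 0 < μ₁ := hμ₀.trans_le ((hm 0).1.trans (hm 0).2)
  have hkpos : ∀ j, 0 < k j := fun j => hκ₀.trans_le (hk j).1
  have hmpos : ∀ j, 0 < m j := fun j => hμ₀.trans_le (hm j).1
  set ν : ℝ := 1 / σ with hν
  have hν0 : 0 < ν := by positivity
  have hσν : σ * ν = 1 := by rw [hν]; field_simp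
  set M : ℝ := 1 / κ₀ * 2 + 2 * ν + 2 * ν * (2 + c * σ / κ₀) + 2 * (2 + μ₁ * (c / σ)) with hM
  have hM1 : 0 < 1 / κ₀ * 2 := by positivity
  have hM2 : 0 < 2 * ν * (2 + c * σ / κ₀) := by positivity
  have hM3 : 0 < 2 * (2 + μ₁ * (c / σ)) := by positivity
  have hM0 : 0 < M := by positivity
  refine ⟨C₁ * (2 + T) * M + M, by positivity, ?_⟩
  intro A A₁ A₂ B B₁ B₂ hA hA₁ hB hB₁ ε hε D g hg hAD hBD r₀ p₀ r p hsol hr₀ hp₀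
  have hε0 := hε.1
  have hε1 : ε ≤ 1 := by linarith [hε.2]
  have hgnn : ∀ j, 0 ≤ g j := fun j => by
    rw [hg]
    exact mul_nonneg (zero_le_one.trans (hρ j).1)
      ((abs_nonneg _).trans (hAD j 0 (by rw [abs_zero]; positivity)).1)
  have htS : ∀ t ∈ Set.Ioo (-(T / ε)) (T / ε), |ε * (c * t)| + |ε| ≤ c * T + 1 := by
    intro t ht
    have h1 : |t| ≤ T / ε := (abs_lt.mpr ht).le
    rw [le_div_iff₀ hε0] at h1
    rw [abs_mul, abs_mul, abs_of_pos hε0, abs_of_pos hc]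
    nlinarith
  have htS' : ∀ t ∈ Set.Ioo (-(T / ε)) (T / ε), |ε * (c * t)| ≤ c * T + 1 := fun t ht =>
    (le_add_of_nonneg_right (abs_nonneg ε)).trans (htS t ht)
  have h11 : |(1 : ℝ)| + |(1 : ℝ)| = 2 := by norm_num
  have hνν : |(-ν)| + |ν| = 2 * ν := by rw [abs_neg, abs_of_pos hν0]; ring
  -- The macroscopic fields `Q`, `P` and their first two space derivatives.
  set Q : ℝ → ℝ → ℝ := wave 1 1 A B ε c with hQ
  set Q₁ : ℝ → ℝ → ℝ := wave 1 1 A₁ B₁ ε c with hQ₁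
  set Q₂ : ℝ → ℝ → ℝ := wave 1 1 A₂ B₂ ε c with hQ₂
  set P : ℝ → ℝ → ℝ := wave (-ν) ν A B ε c with hP
  set P₁ : ℝ → ℝ → ℝ := wave (-ν) ν A₁ B₁ ε c with hP₁
  set P₂ : ℝ → ℝ → ℝ := wave (-ν) ν A₂ B₂ ε c with hP₂
  have bQ : ∀ t ∈ Set.Ioo (-(T / ε)) (T / ε), ∀ j : ℤ,
      |Q t j| ≤ 2 * D j ∧ |Q₁ t j| ≤ 2 * D j ∧ |Q₂ t j| ≤ 2 * D j := by
    intro t ht j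
    rw [← h11]
    exact ⟨abs_wave_le (htS' t ht) (fun s hs => (hAD j s hs).1) (fun s hs => (hBD j s hs).1) 1 1,
      abs_wave_le (htS' t ht) (fun s hs => (hAD j s hs).2.1) (fun s hs => (hBD j s hs).2.1) 1 1,
      abs_wave_le (htS' t ht) (fun s hs => (hAD j s hs).2.2) (fun s hs => (hBD j s hs).2.2) 1 1⟩
  have bP : ∀ t ∈ Set.Ioo (-(T / ε)) (T / ε), ∀ j : ℤ,
      |P t j| ≤ 2 * ν * D j ∧ |P₁ t j| ≤ 2 * ν * D j ∧ |P₂ t j| ≤ 2 * ν * D j := by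
    intro t ht j
    rw [← hνν]
    exact ⟨abs_wave_le (htS' t ht) (fun s hs => (hAD j s hs).1) (fun s hs => (hBD j s hs).1) _ _,
      abs_wave_le (htS' t ht) (fun s hs => (hAD j s hs).2.1) (fun s hs => (hBD j s hs).2.1) _ _,
      abs_wave_le (htS' t ht) (fun s hs => (hAD j s hs).2.2) (fun s hs => (hBD j s hs).2.2) _ _⟩
  -- The wave equation for the macroscopic fields: `Q_t = ε c σ P_x`, `P_t = ε (c / σ) Q_x`.
  have hsmulP : ∀ (F G : ℝ → ℝ) (t x : ℝ),
      wave (-1) 1 F G ε c t x = σ * wave (-ν) ν F G ε c t x := fun F G t x => by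
    rw [← wave_smul, mul_neg, hσν]
  have hsmulQ : ∀ (F G : ℝ → ℝ) (t x : ℝ),
      wave (-(-ν)) ν F G ε c t x = ν * wave 1 1 F G ε c t x := fun F G t x => by
    rw [← wave_smul, neg_neg, mul_one]
  have dQ : ∀ t x, HasDerivAt (fun t => Q t x) (ε * c * (σ * P₁ t x)) t := fun t x => by
    rw [← hsmulP]; exact hasDerivAt_wave hA hB 1 1 ε c t x
  have dQ₁ : ∀ t x, HasDerivAt (fun t => Q₁ t x) (ε * c * (σ * P₂ t x)) t := fun t x => by
    rw [← hsmulP]; exact hasDerivAt_wave hA₁ hB₁ 1 1 ε c t x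
  have dP : ∀ t x, HasDerivAt (fun t => P t x) (ε * c * (ν * Q₁ t x)) t := fun t x => by
    rw [← hsmulQ]; exact hasDerivAt_wave hA hB (-ν) ν ε c t x
  have dP₁ : ∀ t x, HasDerivAt (fun t => P₁ t x) (ε * c * (ν * Q₂ t x)) t := fun t x => by
    rw [← hsmulQ]; exact hasDerivAt_wave hA₁ hB₁ (-ν) ν ε c t x
  -- The corrected ansatz and its time derivative, as curves in `ℓ²`.
  have hkinv : ∀ j, 0 ≤ 1 / k j ∧ 1 / k j ≤ 1 / κ₀ := fun j =>
    ⟨(one_div_pos.mpr (hkpos j)).le, one_div_le_one_div_of_le hκ₀ (hk j).1⟩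
  have hscale : ∀ {w y N : ℝ} {j : ℤ}, 0 ≤ w → |y| ≤ N * D j → |ε * c * (w * y)| ≤
      c * w * N * D j := by
    intro w y N j hw hy
    rw [abs_mul, abs_mul, abs_mul, abs_of_pos hε0, abs_of_pos hc, abs_of_nonneg hw]
    calc ε * c * (w * |y|) ≤ 1 * c * (w * (N * D j)) := by gcongr
      _ = _ := by ring
  have bRt : ∀ t ∈ Set.Ioo (-(T / ε)) (T / ε), ∀ j : ℤ,
      |1 / k j * (Q t j + ε * b j * Q₁ t j)| ≤ 1 / κ₀ * (2 * 2) * g j := fun t ht j => by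
    rw [hg]
    exact abs_mul_add_corrector_le (hkinv j).1 (hkinv j).2 hε0.le hε1 (hρ j).1 (hρ j).2.2.2.1
      (bQ t ht j).1 (bQ t ht j).2.1
  have bRt' : ∀ t ∈ Set.Ioo (-(T / ε)) (T / ε), ∀ j : ℤ,
      |1 / k j * (ε * c * (σ * P₁ t j) + ε * b j * (ε * c * (σ * P₂ t j)))| ≤
        1 / κ₀ * (2 * (c * σ * (2 * ν))) * g j := fun t ht j => by
    rw [hg]
    exact abs_mul_add_corrector_le (hkinv j).1 (hkinv j).2 hε0.le hε1 (hρ j).1 (hρ j).2.2.2.1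
      (hscale hσ.le (bP t ht j).2.1) (hscale hσ.le (bP t ht j).2.2)
  have bVt : ∀ t ∈ Set.Ioo (-(T / ε)) (T / ε), ∀ j : ℤ,
      |1 * (P t j + ε * a j * P₁ t j)| ≤ 1 * (2 * (2 * ν)) * g j := fun t ht j => by
    rw [hg]
    exact abs_mul_add_corrector_le zero_le_one le_rfl hε0.le hε1 (hρ j).1 (hρ j).2.1
      (bP t ht j).1 (bP t ht j).2.1
  have bVt' : ∀ t ∈ Set.Ioo (-(T / ε)) (T / ε), ∀ j : ℤ,
      |1 * (ε * c * (ν * Q₁ t j) + ε * a j * (ε * c * (ν * Q₂ t j)))| ≤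
        1 * (2 * (c * ν * 2)) * g j := fun t ht j => by
    rw [hg]
    exact abs_mul_add_corrector_le zero_le_one le_rfl hε0.le hε1 (hρ j).1 (hρ j).2.1
      (hscale hν0.le (bQ t ht j).2.1) (hscale hν0.le (bQ t ht j).2.2)
  have hcurve : ∀ {F : ℝ → ℤ → ℝ} {N : ℝ}, 0 ≤ N →
      (∀ t ∈ Set.Ioo (-(T / ε)) (T / ε), ∀ j, |F t j| ≤ N * g j) →
      ∃ U : ℝ → EllTwo, ∀ t ∈ Set.Ioo (-(T / ε)) (T / ε), (∀ j, U t j = F t j) ∧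
        ‖U t‖ ≤ N * ‖g‖ := by
    intro F N hN hF
    have : ∀ t, ∃ u : EllTwo, t ∈ Set.Ioo (-(T / ε)) (T / ε) →
        (∀ j, u j = F t j) ∧ ‖u‖ ≤ N * ‖g‖ := by
      intro t
      by_cases ht : t ∈ Set.Ioo (-(T / ε)) (T / ε)
      · obtain ⟨u, hu⟩ := exists_ellTwo_of_abs_le hN (hF t ht)
        exact ⟨u, fun _ => hu⟩
      · exact ⟨0, fun h => absurd h ht⟩
    choose U hU using this
    exact ⟨U, hU⟩
  obtain ⟨Rt, hRt⟩ := hcurve (by positivity) bRt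
  obtain ⟨Rt', hRt'⟩ := hcurve (by positivity) bRt'
  obtain ⟨Vt, hVt⟩ := hcurve (by positivity) bVt
  obtain ⟨Vt', hVt'⟩ := hcurve (by positivity) bVt'
  have dRt : ∀ t ∈ Set.Ioo (-(T / ε)) (T / ε), HasDerivAt Rt (Rt' t) t := fun t ht => by
    refine hasDerivAt_ellTwo_of_dominated (g := (1 / κ₀ * (2 * (c * σ * (2 * ν)))) • g) ht
      (fun s hs j => ?_) bRt' (hRt' t ht).1
    have h := ((dQ s j).add ((dQ₁ s j).const_mul (ε * b j))).const_mul (1 / k j)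
    refine h.congr_of_eventuallyEq ?_
    filter_upwards [Ioo_mem_nhds hs.1 hs.2] with u hu
    exact (hRt u hu).1 j
  have dVt : ∀ t ∈ Set.Ioo (-(T / ε)) (T / ε), HasDerivAt Vt (Vt' t) t := fun t ht => by
    refine hasDerivAt_ellTwo_of_dominated (g := (1 * (2 * (c * ν * 2))) • g) ht
      (fun s hs j => ?_) bVt' (hVt' t ht).1
    have h := ((dP s j).add ((dP₁ s j).const_mul (ε * a j))).const_mul 1
    refine h.congr_of_eventuallyEq ?_
    filter_upwards [Ioo_mem_nhds hs.1 hs.2] with u hu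
    exact (hVt u hu).1 j
  -- The residuals of the corrected ansatz.
  have bf : ∀ t ∈ Set.Ioo (-(T / ε)) (T / ε), ∀ j : ℤ,
      |1 * (P t ((j + 1 : ℤ) : ℝ) + ε * a (j + 1) * P₁ t ((j + 1 : ℤ) : ℝ)) -
        1 * (P t j + ε * a j * P₁ t j) -
        1 / k j * (ε * c * (σ * P₁ t j) + ε * b j * (ε * c * (σ * P₂ t j)))| ≤
        ε ^ 2 * (2 * ν * (2 + c * σ / κ₀)) * g j := by
    intro t ht j
    have e : 1 * (P t ((j + 1 : ℤ) : ℝ) + ε * a (j + 1) * P₁ t ((j + 1 : ℤ) : ℝ)) -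
        1 * (P t j + ε * a j * P₁ t j) -
        1 / k j * (ε * c * (σ * P₁ t j) + ε * b j * (ε * c * (σ * P₂ t j))) =
        (P t (j + 1) - P t j - ε * 1 * P₁ t j) + ε * a (j + 1) * (P₁ t (j + 1) - P₁ t j) -
        ε ^ 2 * b j * (c * σ / k j) * P₂ t j := by
      have h := ha j
      have h' : c * σ / k j = a (j + 1) - a j + 1 := by linarith
      push_cast
      have h2 : 1 / k j * (ε * c * (σ * P₁ t j) + ε * b j * (ε * c * (σ * P₂ t j))) =
          ε * (c * σ / k j) * P₁ t j + ε ^ 2 * b j * (c * σ / k j) * P₂ t j := by ring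
      rw [h2, h']
      ring
    rw [e, hg]
    refine abs_residual_le (hρ j).1 hε0.le (by have := hkpos j; positivity) ?_ (hρ j).2.2.1
      (hρ j).2.2.2.1 ?_ ?_ (bP t ht j).2.2
    · exact div_le_div_of_nonneg_left (by positivity) hκ₀ (hk j).1
    · rw [← hνν]
      exact abs_wave_taylor_le hA hA₁ hB hB₁ abs_one (htS t ht)
        (fun s hs => (hAD j s hs).2.2) (fun s hs => (hBD j s hs).2.2) _ _
    · rw [← hνν, ← abs_of_pos hε0]
      have h := abs_wave_sub_le hA₁ hB₁ abs_one (htS t ht)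
        (fun s hs => (hAD j s hs).2.2) (fun s hs => (hBD j s hs).2.2) (-ν) ν
      rwa [abs_of_pos hε0] at h ⊢
  have bh : ∀ t ∈ Set.Ioo (-(T / ε)) (T / ε), ∀ j : ℤ,
      |k j * (1 / k j * (Q t j + ε * b j * Q₁ t j)) -
        k (j - 1) * (1 / k (j - 1) * (Q t ((j - 1 : ℤ) : ℝ) +
          ε * b (j - 1) * Q₁ t ((j - 1 : ℤ) : ℝ))) -
        m j * (1 * (ε * c * (ν * Q₁ t j) + ε * a j * (ε * c * (ν * Q₂ t j))))| ≤
        ε ^ 2 * (2 * (2 + μ₁ * (c / σ))) * g j := by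
    intro t ht j
    have e : k j * (1 / k j * (Q t j + ε * b j * Q₁ t j)) -
        k (j - 1) * (1 / k (j - 1) * (Q t ((j - 1 : ℤ) : ℝ) +
          ε * b (j - 1) * Q₁ t ((j - 1 : ℤ) : ℝ))) -
        m j * (1 * (ε * c * (ν * Q₁ t j) + ε * a j * (ε * c * (ν * Q₂ t j)))) =
        -(Q t (j + -1) - Q t j - ε * -1 * Q₁ t j) +
        ε * b (j - 1) * (-(Q₁ t (j + -1) - Q₁ t j)) -
        ε ^ 2 * a j * (m j * (c / σ)) * Q₂ t j := by
      have h := hb j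
      have h' : b j = b (j - 1) + m j * (c * ν) - 1 := by
        rw [hν, mul_one_div]; linarith
      have e1 : ∀ i y, k i * (1 / k i * y) = y := fun i y => by
        rw [← mul_assoc, mul_one_div_cancel (hkpos i).ne', one_mul]
      have e2 : c / σ = c * ν := by rw [hν, mul_one_div]
      rw [e1, e1, e2, h']
      push_cast
      rw [← sub_eq_add_neg]
      ring
    rw [e, hg]
    refine abs_residual_le (hρ j).1 hε0.le (by have := hmpos j; positivity) ?_ (hρ j).2.2.2.2
      (hρ j).2.1 ?_ ?_ (bQ t ht j).2.2
    · gcongr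
      exact (hm j).2
    · rw [← h11, abs_neg]
      exact abs_wave_taylor_le hA hA₁ hB hB₁ (by norm_num) (htS t ht)
        (fun s hs => (hAD j s hs).2.2) (fun s hs => (hBD j s hs).2.2) 1 1
    · rw [← h11, abs_neg]
      have h := abs_wave_sub_le hA₁ hB₁ (h := -1) (by norm_num) (htS t ht)
        (fun s hs => (hAD j s hs).2.2) (fun s hs => (hBD j s hs).2.2) 1 1
      rwa [abs_of_pos hε0] at h
  obtain ⟨f, hf⟩ := hcurve (by positivity) bf
  obtain ⟨h, hh⟩ := hcurve (by positivity) bh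
  -- The correctors themselves.
  have bcR : ∀ t ∈ Set.Ioo (-(T / ε)) (T / ε), ∀ j : ℤ,
      |1 / k j * (ε * b j * Q₁ t j)| ≤ ε * (1 / κ₀ * 2) * g j := by
    intro t ht j
    rw [hg, abs_mul, abs_mul, abs_mul, abs_of_nonneg (hkinv j).1, abs_of_pos hε0]
    have := (hρ j).1
    calc 1 / k j * (ε * |b j| * |Q₁ t j|) ≤ 1 / κ₀ * (ε * ρ j * (2 * D j)) := by
          gcongr
          · exact (hk j).1
          · exact (hρ j).2.2.2.1
          · exact (bQ t ht j).2.1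
      _ = _ := by ring
  have bcV : ∀ t ∈ Set.Ioo (-(T / ε)) (T / ε), ∀ j : ℤ,
      |ε * a j * P₁ t j| ≤ ε * (2 * ν) * g j := by
    intro t ht j
    rw [hg, abs_mul, abs_mul, abs_of_pos hε0]
    have := (hρ j).1
    calc ε * |a j| * |P₁ t j| ≤ ε * ρ j * (2 * ν * D j) := by
          gcongr
          · exact (hρ j).2.1
          · exact (bP t ht j).2.1
      _ = _ := by ring
  obtain ⟨cR, hcR⟩ := hcurve (by positivity) bcR
  obtain ⟨cV, hcV⟩ := hcurve (by positivity) bcV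
  have hX := norm_nonneg g
  have hmono : ∀ y : ℝ, y ≤ M → ε * y * ‖g‖ ≤ ε * M * ‖g‖ := fun y hy => by gcongr
  have h0 : (0 : ℝ) ∈ Set.Ioo (-(T / ε)) (T / ε) := by
    have : 0 < T / ε := by positivity
    constructor <;> linarith
  have hinit1 : ‖r 0 - Rt 0‖ ≤ ε * M * ‖g‖ := by
    have e : r 0 - Rt 0 = -cR 0 := by
      ext j
      rw [lp.coeFn_sub, lp.coeFn_neg, Pi.sub_apply, Pi.neg_apply, hsol.init_r, (hRt 0 h0).1,
        (hcR 0 h0).1, hr₀]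
      simp only [hQ, wave, mul_zero, sub_zero, add_zero, one_mul]
      ring
    rw [e, norm_neg]
    exact (hcR 0 h0).2.trans (hmono _ (by rw [hM]; linarith))
  have hinit2 : ‖p 0 - Vt 0‖ ≤ ε * M * ‖g‖ := by
    have e : p 0 - Vt 0 = -cV 0 := by
      ext j
      rw [lp.coeFn_sub, lp.coeFn_neg, Pi.sub_apply, Pi.neg_apply, hsol.init_p, (hVt 0 h0).1,
        (hcV 0 h0).1, hp₀]
      simp only [hP, wave, mul_zero, sub_zero, add_zero]
      ring
    rw [e, norm_neg]
    exact (hcV 0 h0).2.trans (hmono _ (by rw [hM]; linarith))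
  have hres := henergy (fun t => r t - Rt t) (fun t => p t - Vt t)
    (fun t => deriv r t - Rt' t) (fun t => deriv p t - Vt' t) f h (T / ε) (ε ^ 2 * M * ‖g‖)
    (by positivity) (fun t ht => (hsol.differentiable_r t).hasDerivAt.sub (dRt t ht))
    (fun t ht => (hsol.differentiable_p t).hasDerivAt.sub (dVt t ht))
    (fun t ht j => by
      simp only [lp.coeFn_sub, Pi.sub_apply]
      rw [hsol.deriv_r, (hf t ht).1, (hRt' t ht).1, (hVt t ht).1, (hVt t ht).1]
      ring)
    (fun t ht j => by
      simp only [lp.coeFn_sub, Pi.sub_apply]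
      rw [hsol.deriv_p, (hh t ht).1, (hRt t ht).1, (hRt t ht).1, (hVt' t ht).1, mul_sub,
        ← mul_assoc (m j) (1 / m j), mul_one_div_cancel (hmpos j).ne']
      ring)
    (fun t ht => (hf t ht).2.trans (by gcongr; rw [hM]; linarith))
    (fun t ht => (hh t ht).2.trans (by gcongr; rw [hM]; linarith))
  intro t ht
  have hsum : C₁ * (‖r 0 - Rt 0‖ + ‖p 0 - Vt 0‖ + T / ε * (ε ^ 2 * M * ‖g‖)) ≤
      C₁ * (2 + T) * M * ε * ‖g‖ := by
    have e : T / ε * (ε ^ 2 * M * ‖g‖) = T * (ε * M * ‖g‖) := by field_simp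
    rw [e]
    calc _ ≤ C₁ * (ε * M * ‖g‖ + ε * M * ‖g‖ + T * (ε * M * ‖g‖)) := by gcongr
      _ = _ := by ring
  obtain ⟨hfin1, hfin2⟩ := hres t ht
  refine ⟨(r t - Rt t) + cR t, (p t - Vt t) + cV t, fun j => ?_, fun j => ?_, ?_, ?_⟩
  · rw [lp.coeFn_add, lp.coeFn_sub, Pi.add_apply, Pi.sub_apply, (hRt t ht).1, (hcR t ht).1]
    simp only [hQ, wave]
    ring
  · rw [lp.coeFn_add, lp.coeFn_sub, Pi.add_apply, Pi.sub_apply, (hVt t ht).1, (hcV t ht).1]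
    simp only [hP, wave]
    ring
  · calc _ ≤ _ := norm_add_le _ _
      _ ≤ C₁ * (2 + T) * M * ε * ‖g‖ + ε * M * ‖g‖ :=
        add_le_add (hfin1.trans hsum)
          ((hcR t ht).2.trans (hmono _ (by rw [hM]; linarith)))
      _ = _ := by ring
  · calc _ ≤ _ := norm_add_le _ _
      _ ≤ C₁ * (2 + T) * M * ε * ‖g‖ + ε * M * ‖g‖ :=
        add_le_add (hfin2.trans hsum)
          ((hcV t ht).2.trans (hmono _ (by rw [hM]; linarith)))
      _ = _ := by ring

/-! ### The almost sure bound -/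

lemma exists_ellTwo_of_tsum_le {f : ℤ → ℝ} {c : ℝ} (hc : 0 ≤ c)
    (h : ∑' j, ENNReal.ofReal (f j ^ 2) ≤ ENNReal.ofReal (c ^ 2)) :
    ∃ x : EllTwo, (∀ j, x j = f j) ∧ ‖x‖ ≤ c := by
  have hs : Summable fun j => f j ^ 2 := by
    have h1 := ENNReal.summable_toReal (ne_top_of_le_ne_top ENNReal.ofReal_ne_top h)
    simpa [ENNReal.toReal_ofReal, sq_nonneg] using h1
  obtain ⟨x, hx⟩ := exists_ellTwo_of_summable hs
  refine ⟨x, hx, le_of_sq_le_sq ?_ hc⟩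
  rw [← ENNReal.ofReal_tsum_of_nonneg (fun j => sq_nonneg _) hs,
    ENNReal.ofReal_le_ofReal_iff (sq_nonneg c)] at h
  rw [← (hasSum_sq x).tsum_eq]
  simpa only [hx] using h

lemma hasDerivAt_profileA {Φ Φ₁ Ψ Ψ₁ : ℝ → ℝ} (kt mb : ℝ) (hΦ : ∀ x, HasDerivAt Φ (Φ₁ x) x)
    (hΨ : ∀ x, HasDerivAt Ψ (Ψ₁ x) x) (x : ℝ) :
    HasDerivAt (profileA kt mb Φ Ψ) (profileA kt mb Φ₁ Ψ₁ x) x :=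
  ((hΦ x).const_mul _).sub ((hΨ x).const_mul _)

lemma hasDerivAt_profileB {Φ Φ₁ Ψ Ψ₁ : ℝ → ℝ} (kt mb : ℝ) (hΦ : ∀ x, HasDerivAt Φ (Φ₁ x) x)
    (hΨ : ∀ x, HasDerivAt Ψ (Ψ₁ x) x) (x : ℝ) :
    HasDerivAt (profileB kt mb Φ Ψ) (profileB kt mb Φ₁ Ψ₁ x) x :=
  ((hΦ x).const_mul _).add ((hΨ x).const_mul _)

lemma abs_profile_le (kt mb : ℝ) {Φ Ψ : ℝ → ℝ} {x d d' : ℝ} (h : |Φ x| ≤ d) (h' : |Ψ x| ≤ d') :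
    |profileA kt mb Φ Ψ x| ≤ (1 + Real.sqrt (kt * mb)) * (d + d') ∧
      |profileB kt mb Φ Ψ x| ≤ (1 + Real.sqrt (kt * mb)) * (d + d') := by
  have hσ := Real.sqrt_nonneg (kt * mb)
  have hd := (abs_nonneg _).trans h
  have hd' := (abs_nonneg _).trans h'
  have h1 : |1 / 2 * Φ x| ≤ d := by
    rw [abs_mul, abs_of_pos (by norm_num : (0 : ℝ) < 1 / 2)]
    linarith
  have h2 : |Real.sqrt (kt * mb) / 2 * Ψ x| ≤ Real.sqrt (kt * mb) * d' := by
    rw [abs_mul, abs_of_nonneg (by positivity)]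
    refine mul_le_mul ?_ h' (abs_nonneg _) hσ
    linarith
  have h3 : d + Real.sqrt (kt * mb) * d' ≤ (1 + Real.sqrt (kt * mb)) * (d + d') := by
    nlinarith [mul_nonneg hσ hd]
  exact ⟨(abs_sub _ _).trans (by linarith), (abs_add_le _ _).trans (by linarith)⟩

/-- The bound for one realization of the coefficients, given that the walks built from their
fluctuations grow like `√(|j| log log |j|)`. -/
theorem exists_bound_of_abs_intWalk_le {k m : ℤ → ℝ} {ak bk am bm kt mb T₀ K K' : ℝ}
    (hak : 0 < ak) (ham : 0 < am) (hk : ∀ j, 1 / k j ∈ Set.Icc ak bk)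
    (hm : ∀ j, m j ∈ Set.Icc am bm) (hkt : 0 < kt) (hmb : 0 < mb) (hT₀ : 0 < T₀)
    (hK : 0 ≤ K) (hK' : 0 ≤ K')
    (hW : ∀ j, |intWalk (fun i => kt * (1 / k i) - 1) j| ≤ K * lilWeight j)
    (hW' : ∀ j, |intWalk (fun i => m i * (1 / mb) - 1) j| ≤ K' * lilWeight j) :
    ∃ C : ℝ → ℝ → ℝ, (∀ x y, 0 < C x y) ∧
      ∀ Φ Ψ : ℝ → ℝ, MemHLil 3 Φ → MemHLil 3 Ψ → ∀ ε ∈ Set.Ioo (0 : ℝ) (1 / 2),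
        ∃ r p : ℝ → EllTwo,
          IsSolution k m (fun j => Φ (ε * j) / k j) (fun j => Ψ (ε * j)) r p ∧
          (∀ r' p' : ℝ → EllTwo, IsSolution k m (fun j => Φ (ε * j) / k j)
            (fun j => Ψ (ε * j)) r' p' → r' = r ∧ p' = p) ∧
          (⨆ t ∈ Set.Icc (-(T₀ / ε)) (T₀ / ε),
            ellTwoNorm (fun j => r t j - approxR kt mb Φ Ψ ε k t j)) ≤
              ENNReal.ofReal (C (lilNorm 3 Φ).toReal (lilNorm 3 Ψ).toReal *
                Real.sqrt (logLog (1 / ε))) ∧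
          (⨆ t ∈ Set.Icc (-(T₀ / ε)) (T₀ / ε),
            ellTwoNorm (fun j => p t j - approxP kt mb Φ Ψ ε t j)) ≤
              ENNReal.ofReal (C (lilNorm 3 Φ).toReal (lilNorm 3 Ψ).toReal *
                Real.sqrt (logLog (1 / ε))) := by
  have hbk : 0 < bk := hak.trans_le ((hk 0).1.trans (hk 0).2)
  have hkpos : ∀ j, 0 < k j := fun j => one_div_pos.mp (hak.trans_le (hk j).1)
  have hkI : ∀ j, k j ∈ Set.Icc (1 / bk) (1 / ak) := fun j =>
    ⟨(one_div_le (hkpos j) hbk).mp (hk j).2, (le_one_div hak (hkpos j)).mp (hk j).1⟩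
  have hmpos : ∀ j, 0 < m j := fun j => ham.trans_le (hm j).1
  set σ : ℝ := Real.sqrt (kt * mb) with hσ
  set c : ℝ := waveSpeed kt mb with hc
  have hσ0 : 0 < σ := Real.sqrt_pos.mpr (by positivity)
  have hc0 : 0 < c := Real.sqrt_pos.mpr (by positivity)
  have hcσ : c * σ = kt := by
    rw [hc, hσ, waveSpeed, ← Real.sqrt_mul (by positivity),
      show kt / mb * (kt * mb) = kt ^ 2 by field_simp, Real.sqrt_sq hkt.le]
  have hcdσ : c / σ = 1 / mb := by
    rw [hc, hσ, waveSpeed, ← Real.sqrt_div (by positivity),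
      show kt / mb / (kt * mb) = (1 / mb) ^ 2 by field_simp, Real.sqrt_sq (by positivity)]
  set a : ℤ → ℝ := intWalk fun i => kt * (1 / k i) - 1 with ha
  set W : ℤ → ℝ := intWalk fun i => m i * (1 / mb) - 1 with hWdef
  set ρ : ℤ → ℝ := fun j => 1 + |a j| + |a (j + 1)| + |W (j + 1)| + |W j| with hρ
  have hρ1 : ∀ j, 1 ≤ ρ j ∧ |a j| ≤ ρ j ∧ |a (j + 1)| ≤ ρ j ∧ |W (j + 1)| ≤ ρ j ∧
      |W (j - 1 + 1)| ≤ ρ j := by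
    intro j
    rw [sub_add_cancel]
    have h1 := abs_nonneg (a j)
    have h2 := abs_nonneg (a (j + 1))
    have h3 := abs_nonneg (W (j + 1))
    have h4 := abs_nonneg (W j)
    refine ⟨?_, ?_, ?_, ?_, ?_⟩ <;> simp only [hρ] <;> linarith
  have hρK : ∀ j, |ρ j| ≤ (1 + 2 * K + 2 * K') * lilWeight (|(j : ℝ)| + 1) := by
    intro j
    rw [abs_of_nonneg (zero_le_one.trans (hρ1 j).1)]
    have habs : |(|(j : ℝ)| + 1)| = |(j : ℝ)| + 1 := abs_of_nonneg (by positivity)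
    have w0 : lilWeight j ≤ lilWeight (|(j : ℝ)| + 1) :=
      lilWeight_mono (by rw [habs]; linarith)
    have w1 : lilWeight ((j + 1 : ℤ) : ℝ) ≤ lilWeight (|(j : ℝ)| + 1) := by
      refine lilWeight_mono ?_
      rw [habs]
      push_cast
      exact (abs_add_le _ _).trans (by rw [abs_one])
    have w2 := one_le_lilWeight (|(j : ℝ)| + 1)
    have e1 := (hW j).trans (mul_le_mul_of_nonneg_left w0 hK)
    have e2 := (hW (j + 1)).trans (mul_le_mul_of_nonneg_left w1 hK)
    have e3 := (hW' (j + 1)).trans (mul_le_mul_of_nonneg_left w1 hK')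
    have e4 := (hW' j).trans (mul_le_mul_of_nonneg_left w0 hK')
    simp only [hρ]
    linarith
  obtain ⟨C₀, hC₀, hsample⟩ := exists_sample_majorant (fun j => (hρ1 j).1) hρK
    (S := c * (T₀ + 1) + 1) (by positivity)
  obtain ⟨C₁, hC₁, hwave⟩ := exists_norm_sub_wave_le (k := k) (m := m) (a := a)
    (b := fun j => W (j + 1)) (ρ := ρ) (T := T₀ + 1) (one_div_pos.mpr hbk) hkI ham hm hc0 hσ0
    (by positivity)
    (fun j => by rw [hcσ, ha, intWalk_add_one_sub]; ring)
    (fun j => by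
      rw [hcdσ, sub_add_cancel, hWdef, intWalk_add_one_sub])
    hρ1
  set L : ℝ := C₁ * (1 + σ) * Real.sqrt C₀ with hL
  have hL0 : 0 ≤ L := by positivity
  refine ⟨fun x y => L * (|x| + |y|) + 1, fun x y => by positivity, ?_⟩
  intro Φ Ψ hΦ hΨ ε hε
  have hε0 := hε.1
  have hl : 0 ≤ logLog (1 / ε) := logLog_nonneg (by positivity)
  obtain ⟨Φ₁, Φ₂, hΦ1, hΦ2, hΦs⟩ := hsample Φ hΦ
  obtain ⟨Ψ₁, Ψ₂, hΨ1, hΨ2, hΨs⟩ := hsample Ψ hΨ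
  obtain ⟨d, hd0, hd, hdsum⟩ := hΦs ε hε
  obtain ⟨d', hd'0, hd', hd'sum⟩ := hΨs ε hε
  have hsqeq : ∀ x : ℝ, C₀ * (logLog (1 / ε) / ε ^ 2) * x ^ 2 =
      (Real.sqrt C₀ * Real.sqrt (logLog (1 / ε)) / ε * x) ^ 2 := fun x => by
    rw [mul_pow, div_pow, mul_pow, Real.sq_sqrt hC₀.le, Real.sq_sqrt hl]
    ring
  rw [hsqeq] at hdsum hd'sum
  obtain ⟨g, hg, hgn⟩ := exists_ellTwo_of_tsum_le (by positivity) hdsum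
  obtain ⟨g', hg', hgn'⟩ := exists_ellTwo_of_tsum_le (by positivity) hd'sum
  have hS0 : |(0 : ℝ)| ≤ c * (T₀ + 1) + 1 := by rw [abs_zero]; positivity
  have hdg : ∀ j, d j ≤ g j := fun j => by
    rw [hg]; exact le_mul_of_one_le_left (hd0 j) (hρ1 j).1
  have hdg' : ∀ j, d' j ≤ g' j := fun j => by
    rw [hg']; exact le_mul_of_one_le_left (hd'0 j) (hρ1 j).1
  obtain ⟨r₀, hr₀, -⟩ := exists_ellTwo_of_abs_le (f := fun j : ℤ => Φ (ε * j) / k j) (g := g)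
    hbk.le fun j => by
      have h1 := (hd j 0 hS0).1
      rw [add_zero] at h1
      rw [div_eq_mul_one_div, abs_mul, abs_of_pos (one_div_pos.mpr (hkpos j)), mul_comm]
      exact mul_le_mul (hk j).2 (h1.trans (hdg j)) (abs_nonneg _) hbk.le
  obtain ⟨p₀, hp₀, -⟩ := exists_ellTwo_of_abs_le (f := fun j : ℤ => Ψ (ε * j)) (g := g')
    zero_le_one fun j => by
      have h1 := (hd' j 0 hS0).1
      rw [add_zero] at h1
      rw [one_mul]
      exact h1.trans (hdg' j)
  obtain ⟨r, p, hsol, huniq⟩ := exists_unique_isSolution (k := k) (m := m) (κ := 1 / ak)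
    (M := 1 / am) (fun j => by rw [abs_of_pos (hkpos j)]; exact (hkI j).2)
    (fun j => by
      rw [abs_of_pos (one_div_pos.mpr (hmpos j))]
      exact one_div_le_one_div_of_le ham (hm j).1) r₀ p₀
  rw [funext hr₀, funext hp₀] at hsol huniq
  have hgD : ∀ j, ((1 + σ) • (g + g')) j = ρ j * ((1 + σ) * (d j + d' j)) := fun j => by
    have : ((1 + σ) • (g + g')) j = (1 + σ) * (g j + g' j) := rfl
    rw [this, hg, hg']
    ring
  have herr := hwave (profileA kt mb Φ Ψ) (profileA kt mb Φ₁ Ψ₁) (profileA kt mb Φ₂ Ψ₂)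
    (profileB kt mb Φ Ψ) (profileB kt mb Φ₁ Ψ₁) (profileB kt mb Φ₂ Ψ₂)
    (hasDerivAt_profileA kt mb hΦ1 hΨ1) (hasDerivAt_profileA kt mb hΦ2 hΨ2)
    (hasDerivAt_profileB kt mb hΦ1 hΨ1) (hasDerivAt_profileB kt mb hΦ2 hΨ2) ε hε
    (fun j => (1 + σ) * (d j + d' j)) ((1 + σ) • (g + g')) hgD
    (fun j s hs => ⟨(abs_profile_le kt mb (hd j s hs).1 (hd' j s hs).1).1,
      (abs_profile_le kt mb (hd j s hs).2.1 (hd' j s hs).2.1).1,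
      (abs_profile_le kt mb (hd j s hs).2.2 (hd' j s hs).2.2).1⟩)
    (fun j s hs => ⟨(abs_profile_le kt mb (hd j s hs).1 (hd' j s hs).1).2,
      (abs_profile_le kt mb (hd j s hs).2.1 (hd' j s hs).2.1).2,
      (abs_profile_le kt mb (hd j s hs).2.2 (hd' j s hs).2.2).2⟩)
    _ _ r p hsol
    (fun j => by simp only [profileA, profileB]; ring)
    (fun j => by
      simp only [profileA, profileB]
      rw [← hσ]
      field_simp
      ring)
  have hbound : C₁ * ε * ‖(1 + σ) • (g + g')‖ ≤
      (L * (|(lilNorm 3 Φ).toReal| + |(lilNorm 3 Ψ).toReal|) + 1) *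
        Real.sqrt (logLog (1 / ε)) := by
    rw [norm_smul, Real.norm_eq_abs, abs_of_pos (by positivity),
      abs_of_nonneg ENNReal.toReal_nonneg, abs_of_nonneg ENNReal.toReal_nonneg]
    calc C₁ * ε * ((1 + σ) * ‖g + g'‖)
        ≤ C₁ * ε * ((1 + σ) * (Real.sqrt C₀ * Real.sqrt (logLog (1 / ε)) / ε *
            (lilNorm 3 Φ).toReal + Real.sqrt C₀ * Real.sqrt (logLog (1 / ε)) / ε *
            (lilNorm 3 Ψ).toReal)) := by
          gcongr
          exact (norm_add_le _ _).trans (add_le_add hgn hgn')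
      _ = L * ((lilNorm 3 Φ).toReal + (lilNorm 3 Ψ).toReal) * Real.sqrt (logLog (1 / ε)) := by
          rw [hL]
          field_simp
      _ ≤ _ := by gcongr; linarith
  have hIoo : ∀ t ∈ Set.Icc (-(T₀ / ε)) (T₀ / ε),
      t ∈ Set.Ioo (-((T₀ + 1) / ε)) ((T₀ + 1) / ε) := fun t ht => by
    have : T₀ / ε < (T₀ + 1) / ε := by gcongr; linarith
    exact ⟨by linarith [ht.1], by linarith [ht.2]⟩
  refine ⟨r, p, hsol, huniq, iSup₂_le fun t ht => ?_, iSup₂_le fun t ht => ?_⟩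
  · obtain ⟨x, y, hx, -, hxn, -⟩ := herr t (hIoo t ht)
    have e : (fun j => r t j - approxR kt mb Φ Ψ ε k t j) = fun j => x j := by
      funext j
      rw [hx, approxR]
    rw [e]
    exact ellTwoNorm_coe_le x (hxn.trans hbound)
  · obtain ⟨x, y, -, hy, -, hyn⟩ := herr t (hIoo t ht)
    have e : (fun j => p t j - approxP kt mb Φ Ψ ε t j) = fun j => y j := by
      funext j
      rw [hy, approxP]
    rw [e]
    exact ellTwoNorm_coe_le y (hyn.trans hbound)

end RandomLattice

theorem mainTheorem1 {Ω : Type*} [MeasurableSpace Ω] (μ : Measure Ω) [IsProbabilityMeasure μ]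
    (k m : ℤ → Ω → ℝ) (ak bk am bm : ℝ) (hak : 0 < ak) (ham : 0 < am)
    (hk_meas : ∀ j, Measurable (k j)) (hm_meas : ∀ j, Measurable (m j))
    (hk_indep : iIndepFun (fun j ω => 1 / k j ω) μ)
    (hm_indep : iIndepFun m μ)
    (hk_ident : ∀ i j, IdentDistrib (fun ω => 1 / k i ω) (fun ω => 1 / k j ω) μ μ)
    (hm_ident : ∀ i j, IdentDistrib (m i) (m j) μ μ)
    (hk_supp : ∀ j, ∀ᵐ ω ∂μ, 1 / k j ω ∈ Set.Icc ak bk)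
    (hm_supp : ∀ j, ∀ᵐ ω ∂μ, m j ω ∈ Set.Icc am bm)
    (kt mb : ℝ) (hkt : 1 / kt = ∫ ω, 1 / k 0 ω ∂μ) (hmb : mb = ∫ ω, m 0 ω ∂μ)
    (T₀ : ℝ) (hT₀ : 0 < T₀) :
    ∀ᵐ ω ∂μ, ∃ C : ℝ → ℝ → ℝ, (∀ x y, 0 < C x y) ∧
      ∀ Φ Ψ : ℝ → ℝ, RandomLattice.MemHLil 3 Φ → RandomLattice.MemHLil 3 Ψ →
      ∀ ε ∈ Set.Ioo (0 : ℝ) (1 / 2),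
        ∃ r p : ℝ → RandomLattice.EllTwo,
          RandomLattice.IsSolution (fun j => k j ω) (fun j => m j ω)
            (fun j => Φ (ε * j) / k j ω) (fun j => Ψ (ε * j)) r p ∧
          (∀ r' p' : ℝ → RandomLattice.EllTwo,
            RandomLattice.IsSolution (fun j => k j ω) (fun j => m j ω)
              (fun j => Φ (ε * j) / k j ω) (fun j => Ψ (ε * j)) r' p' → r' = r ∧ p' = p) ∧
          (⨆ t ∈ Set.Icc (-(T₀ / ε)) (T₀ / ε), RandomLattice.ellTwoNorm
              (fun j => r t j - RandomLattice.approxR kt mb Φ Ψ ε (fun i => k i ω) t j)) ≤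
            ENNReal.ofReal (C (RandomLattice.lilNorm 3 Φ).toReal (RandomLattice.lilNorm 3 Ψ).toReal *
              Real.sqrt (Real.log (Real.log (1 / ε + Real.exp 1)))) ∧
          (⨆ t ∈ Set.Icc (-(T₀ / ε)) (T₀ / ε), RandomLattice.ellTwoNorm
              (fun j => p t j - RandomLattice.approxP kt mb Φ Ψ ε t j)) ≤
            ENNReal.ofReal (C (RandomLattice.lilNorm 3 Φ).toReal (RandomLattice.lilNorm 3 Ψ).toReal *
              Real.sqrt (Real.log (Real.log (1 / ε + Real.exp 1)))) := by
  have hyk_meas : ∀ j, Measurable fun ω => 1 / k j ω := fun j => (hk_meas j).const_div 1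
  have hyk_int : ∀ j, Integrable (fun ω => 1 / k j ω) μ := fun j =>
    Integrable.of_mem_Icc ak bk (hyk_meas j).aemeasurable (hk_supp j)
  have hm_int : ∀ j, Integrable (m j) μ := fun j =>
    Integrable.of_mem_Icc am bm (hm_meas j).aemeasurable (hm_supp j)
  have hmono : ∀ {f : Ω → ℝ} {a b : ℝ}, Integrable f μ → (∀ᵐ ω ∂μ, f ω ∈ Set.Icc a b) →
      a ≤ ∫ ω, f ω ∂μ := fun hf hs => by
    have h := integral_mono_ae (integrable_const _) hf (hs.mono fun ω h => h.1)
    simpa using h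
  have hkt0 : 0 < kt := one_div_pos.mp (hkt ▸ hak.trans_le (hmono (hyk_int 0) (hk_supp 0)))
  have hmb0 : 0 < mb := hmb ▸ ham.trans_le (hmono (hm_int 0) (hm_supp 0))
  have hk_mean : ∀ j, ∫ ω, (kt * (1 / k j ω) - 1) ∂μ = 0 := fun j => by
    rw [integral_sub ((hyk_int j).const_mul kt) (integrable_const _), integral_const_mul,
      (hk_ident j 0).integral_eq, ← hkt, mul_one_div_cancel hkt0.ne']
    simp
  have hm_mean : ∀ j, ∫ ω, (m j ω * (1 / mb) - 1) ∂μ = 0 := fun j => by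
    rw [integral_sub ((hm_int j).mul_const _) (integrable_const _), integral_mul_const,
      (hm_ident j 0).integral_eq, ← hmb, mul_one_div_cancel hmb0.ne']
    simp
  have hk_all : ∀ᵐ ω ∂μ, ∀ j, 1 / k j ω ∈ Set.Icc ak bk := ae_all_iff.mpr hk_supp
  have hm_all : ∀ᵐ ω ∂μ, ∀ j, m j ω ∈ Set.Icc am bm := ae_all_iff.mpr hm_supp
  obtain ⟨ω₀, hω₀, hω₀'⟩ := (hk_all.and hm_all).exists
  have hab : ak ≤ bk := (hω₀ 0).1.trans (hω₀ 0).2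
  have hab' : am ≤ bm := (hω₀' 0).1.trans (hω₀' 0).2
  -- The intervals are enlarged to be nondegenerate also for constant coefficients.
  have hWk := RandomLattice.ae_exists_abs_intWalk_le (X := fun j ω => kt * (1 / k j ω) - 1)
    (fun j => ((hyk_meas j).const_mul kt).sub_const 1)
    (hk_indep.comp (fun _ x => kt * x - 1) fun _ => by fun_prop)
    (a := kt * ak - 1) (b := kt * bk) (by nlinarith)
    (fun j => (hk_supp j).mono fun ω h => ⟨by nlinarith [h.1], by nlinarith [h.2]⟩) hk_mean
  have hWm := RandomLattice.ae_exists_abs_intWalk_le (X := fun j ω => m j ω * (1 / mb) - 1)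
    (fun j => ((hm_meas j).mul_const _).sub_const 1)
    (hm_indep.comp (fun _ x => x * (1 / mb) - 1) fun _ => by fun_prop)
    (a := am * (1 / mb) - 1) (b := bm * (1 / mb))
    (by have := mul_le_mul_of_nonneg_right hab' (one_div_pos.mpr hmb0).le; linarith)
    (fun j => (hm_supp j).mono fun ω h => by
      have h1 := mul_le_mul_of_nonneg_right h.1 (one_div_pos.mpr hmb0).le
      have h2 := mul_le_mul_of_nonneg_right h.2 (one_div_pos.mpr hmb0).le
      exact ⟨by linarith, by linarith⟩) hm_mean
  filter_upwards [hk_all, hm_all, hWk, hWm] with ω h1 h2 ⟨K, hK, hW⟩ ⟨K', hK', hW'⟩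
  exact RandomLattice.exists_bound_of_abs_intWalk_le hak ham h1 h2 hkt0 hmb0 hT₀ hK hK' hW hW'
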